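/- All Hilbert spaces are finite-dimensional and nonzero, $\log$ is taken to base $2$, $\pi_A=\mathbb 1_A/d_A$, subscripts on operators denote marginals (partial traces), and $J^{\mathcal N}=\sum_{i,j}|i\rangle\langle j|\otimes\mathcal N(|i\rangle\langle j|)$ is the Choi operator of a linear map $\mathcal N$. For a system $A$ let $\mathcal R^\pi_A(\cdot)=\operatorname{tr}_A[\cdot]\otimes\pi_A$; as a supermap it acts on a channel by precomposition if $A$ is an input system and by postcomposition if $A$ is an output system. A superchannel $(A\to B)\to(C\to D)$ is a linear supermap $\Theta$ such that $(\mathbb I_R\otimes\Theta)(\mathcal N_{R_0A\to R_1B})$ is a quantum channel for all reference systems $R_0,R_1$ and all channels $\mathcal N_{R_0A\to R_1B}$. A superchannel $\Theta_{(\bar A_0\bar B_0\to\bar A_1\bar B_1)\to(A_0B_0\to A_1B_1)}$ is a non-signalling bipartite superchannel if $$\mathcal R^\pi_{A_0A_1}\circ\Theta\circ\mathcal R^\pi_{\bar A_0}=\mathcal R^\pi_{A_1}\circ\Theta\circ\mathcal R^\pi_{\bar A_0},\qquad \mathcal R^\pi_{A_1}\circ\Theta\circ\mathcal R^\pi_{\bar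 A_1}=\mathcal R^\pi_{A_1}\circ\Theta,$$ and the same two equations hold with $B$ in place of $A$. Let $e_{\mathrm{NS}}(\mathcal N,\mathcal M)=\frac12\inf_\Theta\|\Theta(\mathcal N)-\mathcal M\|_\diamond$, the infimum being over all non-signalling bipartite superchannels, let $\Upsilon_m$ be the bidirectional noiseless classical channel $|k\rangle\langle k'|\otimes|l\rangle\langle l'|\mapsto\delta_{kk'}\delta_{ll'}\,|l\rangle\langle l|\otimes|k\rangle\langle k|$ ($0\le k,k',l,l'<m$), and define the one-shot exact bidirectional classical communication cost of a bipartite channel $\mathcal N_{A_0B_0\to A_1B_1}$ by $$S^{(1)}_{\leftrightarrow,0}(\mathcal N)=\log\inf\{m\in\mathbb N,\ m\ge1 : e_{\mathrm{NS}}(\Upsilon_m,\mathcal N)\le0\}.$$ **Theorem.** (1) For every bipartite quantum channel $\mathcal N_{A_0B_0\to A_1B_1}$, $$\begin{aligned} S^{(1)}_{\leftrightarrow,0}(\mathcal N)=\log\min\ &\lceil m\rceil\\ \text{s.t. }& V\ge J^{\mathcal N},\quad W\ge J^{\mathcal N},\quad X\ge J^{\mathcal N},\\ & X_{A_0B_0B_1}=\pi_{A_0}\otimes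 X_{B_0B_1},\quad X_{A_0A_1B_0}=\pi_{B_0}\otimes X_{A_0A_1},\\ & mJ^{\mathcal N}_{A_0B_0B_1}=W_{A_0B_0B_1},\quad X_{A_0B_0B_1}=V_{A_0B_0B_1},\\ & mJ^{\mathcal N}_{A_0A_1B_0}=V_{A_0A_1B_0},\quad X_{A_0A_1B_0}=W_{A_0A_1B_0},\end{aligned}$$ where the minimum is over real $m$ and operators $V,W,X$ on $A_0A_1B_0B_1$, and is attained. (2) Let $\mathcal M_{A_0\to B_1}$ be a quantum channel, regarded as a bipartite channel with one-dimensional $B_0$ and $A_1$. Then $H_{\min}(A|B)_{J^{\mathcal M}}:=-\min_\sigma D_{\max}(J^{\mathcal M}\,\|\,\mathbb 1_{A_0}\otimes\sigma_{B_1})$ is finite, where $\sigma$ ranges over density operators on $B_1$ and $D_{\max}(\rho\|\sigma)=\log\min\{t:\rho\le t\sigma\}$, the minimum of the program in (1) is $\lceil 2^{-H_{\min}(A|B)_{J^{\mathcal M}}}\rceil$, and $$S^{(1)}_{\leftrightarrow,0}(\mathcal M)=\log\big\lceil 2^{-H_{\min}(A|B)_{J^{\mathcal M}}}\big\rceil .$$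 -/

import Mathlib

open scoped ENNReal NNReal Kronecker ComplexOrder

namespace BiCost

noncomputable section

/-- Linear operators on the Hilbert space `ℂ^a`; `a` indexes the fixed orthonormal basis.
Composite systems are indexed by product types. -/
abbrev Op (a : Type*) := Matrix a a ℂ

/-- Linear maps from operators on `a` to operators on `b`. -/
abbrev LMap (a b : Type*) := Op a →ₗ[ℂ] Op b

/-- Supermaps: linear maps sending linear maps `a → b` to linear maps `c → d`. -/
abbrev SuperMap (a b c d : Type*) := LMap a b →ₗ[ℂ] LMap c d

/-! ### Channels -/

/-- The map `id_r ⊗ Φ`: `Φ` is applied to every block. -/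
def idTensor (r : Type*) {a b : Type*} (Φ : LMap a b) : LMap (r × a) (r × b) where
  toFun X := Matrix.of fun p q => Φ (X.submatrix (Prod.mk p.1) (Prod.mk q.1)) p.2 q.2
  map_add' X Y := by
    ext p q
    simp [Matrix.submatrix_add]
  map_smul' c X := by
    ext p q
    simp [Matrix.submatrix_smul]

/-- Quantum channels: completely positive and trace-preserving linear maps. -/
structure IsChannel {a b : Type*} [Fintype a] [Fintype b] (Φ : LMap a b) : Prop where
  completelyPositive : ∀ (r : ℕ) (X : Op (Fin r × a)),
    X.PosSemidef → (idTensor (Fin r) Φ X).PosSemidef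
  tracePreserving : ∀ X : Op a, (Φ X).trace = X.trace

/-- The Choi operator `∑ i j, |i⟩⟨j| ⊗ Φ(|i⟩⟨j|)`, input system first. -/
def choi {a b : Type*} [DecidableEq a] (Φ : LMap a b) : Op (a × b) :=
  Matrix.of fun p q => Φ (Matrix.single p.1 q.1 1) p.2 q.2

/-- The maximally mixed state. -/
def maxMixed (a : Type*) [Fintype a] [DecidableEq a] : Op a :=
  (Fintype.card a : ℂ)⁻¹ • (1 : Op a)

/-- The replacement channel of the first tensor factor, `X ↦ π ⊗ tr₁ X`. -/
def replaceFst (a b : Type*) [Fintype a] [DecidableEq a] : LMap (a × b) (a × b) where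
  toFun X := maxMixed a ⊗ₖ (Matrix.of fun y y' => ∑ x, X (x, y) (x, y') : Op b)
  map_add' X Y := by
    ext p q
    simp [Finset.sum_add_distrib, mul_add]
  map_smul' c X := by
    ext p q
    simp [← Finset.mul_sum, mul_left_comm]

/-- The replacement channel of the second tensor factor, `X ↦ tr₂ X ⊗ π`. -/
def replaceSnd (a b : Type*) [Fintype b] [DecidableEq b] : LMap (a × b) (a × b) where
  toFun X := (Matrix.of fun x x' => ∑ y, X (x, y) (x', y) : Op a) ⊗ₖ maxMixed b
  map_add' X Y := by
    ext p q
    simp [Finset.sum_add_distrib, add_mul]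
  map_smul' c X := by
    ext p q
    simp [← Finset.mul_sum, mul_assoc]

/-! ### Superchannels -/

/-- For `N : r₀ a → r₁ b`, the map `a → b` sending `X` to `⟨k| N(|i⟩⟨j| ⊗ X) |l⟩`, where `i j`
are basis labels of `r₀` and `k l` are basis labels of `r₁`. -/
def slice {r₀ r₁ a b : Type*} [DecidableEq r₀] (N : LMap (r₀ × a) (r₁ × b))
    (i j : r₀) (k l : r₁) : LMap a b where
  toFun X := (N (Matrix.single i j (1 : ℂ) ⊗ₖ X)).submatrix (Prod.mk k) (Prod.mk l)
  map_add' X Y := by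
    rw [Matrix.kronecker_add, map_add, Matrix.submatrix_add]
    rfl
  map_smul' c X := by
    rw [Matrix.kronecker_smul, map_smul, Matrix.submatrix_smul]
    rfl

/-- The supermap `𝕀_R ⊗ Θ`, applied to `N : r₀ a → r₁ b`. It is the linear extension of
`F ⊗ G ↦ F ⊗ Θ(G)`. -/
def idTensorSuper {r₀ r₁ a b c d : Type*} [Fintype r₀] [DecidableEq r₀]
    (Θ : SuperMap a b c d) (N : LMap (r₀ × a) (r₁ × b)) : LMap (r₀ × c) (r₁ × d) where
  toFun Y := Matrix.of fun p q => ∑ i, ∑ j,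
    Θ (slice N i j p.1 q.1) (Y.submatrix (Prod.mk i) (Prod.mk j)) p.2 q.2
  map_add' X Y := by
    ext p q
    simp [Matrix.submatrix_add, Finset.sum_add_distrib]
  map_smul' t X := by
    ext p q
    simp [Matrix.submatrix_smul, Finset.mul_sum]

/-- Superchannels: supermaps that send channels to channels, also when they act on a part of a
channel with arbitrary reference systems. -/
def IsSuperchannel {a b c d : Type*} [Fintype a] [Fintype b] [Fintype c] [Fintype d]
    (Θ : SuperMap a b c d) : Prop :=
  ∀ (r₀ r₁ : ℕ) (N : LMap (Fin r₀ × a) (Fin r₁ × b)),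
    IsChannel N → IsChannel (idTensorSuper Θ N)

/-- Non-signalling bipartite superchannels `(a₀ b₀ → a₁ b₁) → (A₀ B₀ → A₁ B₁)`, the lower-case
letters being the barred systems. A replacement channel of an input system acts on a channel by
precomposition, a replacement channel of an output system acts by postcomposition. -/
structure IsNSSuperchannel {a₀ b₀ a₁ b₁ A₀ B₀ A₁ B₁ : Type*}
    [Fintype a₀] [Fintype b₀] [Fintype a₁] [Fintype b₁]
    [Fintype A₀] [Fintype B₀] [Fintype A₁] [Fintype B₁]
    [DecidableEq a₀] [DecidableEq b₀] [DecidableEq a₁] [DecidableEq b₁]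
    [DecidableEq A₀] [DecidableEq B₀] [DecidableEq A₁] [DecidableEq B₁]
    (Θ : SuperMap (a₀ × b₀) (a₁ × b₁) (A₀ × B₀) (A₁ × B₁)) : Prop where
  isSuperchannel : IsSuperchannel Θ
  alice_input : ∀ N : LMap (a₀ × b₀) (a₁ × b₁),
    replaceFst A₁ B₁ ∘ₗ Θ (N ∘ₗ replaceFst a₀ b₀) ∘ₗ replaceFst A₀ B₀ =
      replaceFst A₁ B₁ ∘ₗ Θ (N ∘ₗ replaceFst a₀ b₀)
  alice_output : ∀ N : LMap (a₀ × b₀) (a₁ × b₁),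
    replaceFst A₁ B₁ ∘ₗ Θ (replaceFst a₁ b₁ ∘ₗ N) = replaceFst A₁ B₁ ∘ₗ Θ N
  bob_input : ∀ N : LMap (a₀ × b₀) (a₁ × b₁),
    replaceSnd A₁ B₁ ∘ₗ Θ (N ∘ₗ replaceSnd a₀ b₀) ∘ₗ replaceSnd A₀ B₀ =
      replaceSnd A₁ B₁ ∘ₗ Θ (N ∘ₗ replaceSnd a₀ b₀)
  bob_output : ∀ N : LMap (a₀ × b₀) (a₁ × b₁),
    replaceSnd A₁ B₁ ∘ₗ Θ (replaceSnd a₁ b₁ ∘ₗ N) = replaceSnd A₁ B₁ ∘ₗ Θ N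

/-! ### Simulation error and cost -/

/-- The trace norm: the sum of the singular values. -/
def traceNorm {a : Type*} [Fintype a] [DecidableEq a] (X : Op a) : ℝ :=
  ∑ i, Real.sqrt ((Matrix.isHermitian_conjTranspose_mul_self X).eigenvalues i)

/-- The diamond norm. -/
def diamondNorm {a b : Type*} [Fintype a] [Fintype b] [DecidableEq a] [DecidableEq b]
    (F : LMap a b) : ℝ≥0∞ :=
  ⨆ (k : ℕ) (X : Op (Fin k × a)) (_ : traceNorm X ≤ 1),
    ENNReal.ofReal (traceNorm (idTensor (Fin k) F X))

/-- The minimum error of simulation from `N` to `M` via non-signalling bipartite superchannels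
(`⊤` if there are none). -/
def simError {a₀ b₀ a₁ b₁ A₀ B₀ A₁ B₁ : Type*}
    [Fintype a₀] [Fintype b₀] [Fintype a₁] [Fintype b₁]
    [Fintype A₀] [Fintype B₀] [Fintype A₁] [Fintype B₁]
    [DecidableEq a₀] [DecidableEq b₀] [DecidableEq a₁] [DecidableEq b₁]
    [DecidableEq A₀] [DecidableEq B₀] [DecidableEq A₁] [DecidableEq B₁]
    (N : LMap (a₀ × b₀) (a₁ × b₁)) (M : LMap (A₀ × B₀) (A₁ × B₁)) : ℝ≥0∞ :=
  2⁻¹ * ⨅ (Θ : SuperMap (a₀ × b₀) (a₁ × b₁) (A₀ × B₀) (A₁ × B₁)) (_ : IsNSSuperchannel Θ),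
    diamondNorm (Θ N - M)

/-- The bidirectional noiseless classical channel with `m` messages in each direction,
`X ↦ ∑ k l, ⟨k l| X |k l⟩ |l k⟩⟨l k|`. -/
def noiseless (m : ℕ) : LMap (Fin m × Fin m) (Fin m × Fin m) where
  toFun X := ∑ k, ∑ l, Matrix.single (l, k) (l, k) (X (k, l) (k, l))
  map_add' X Y := by
    simp only [Matrix.add_apply, Matrix.single_add, Finset.sum_add_distrib]
  map_smul' c X := by
    simp only [Matrix.smul_apply, ← Matrix.smul_single, Finset.smul_sum, RingHom.id_apply]

/-- The base-2 logarithm with values in the extended reals. -/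
def log2 (x : ℝ≥0∞) : EReal := ENNReal.log x / ENNReal.log 2

/-- The one-shot `ε`-error bidirectional classical communication cost via non-signalling
bipartite superchannels. -/
def oneShotCost {A₀ B₀ A₁ B₁ : Type*}
    [Fintype A₀] [Fintype B₀] [Fintype A₁] [Fintype B₁]
    [DecidableEq A₀] [DecidableEq B₀] [DecidableEq A₁] [DecidableEq B₁]
    (ε : ℝ≥0∞) (N : LMap (A₀ × B₀) (A₁ × B₁)) : EReal :=
  log2 (⨅ (m : ℕ) (_ : 0 < m ∧ simError (noiseless m) N ≤ ε), (m : ℝ≥0∞))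

/-! ### The semidefinite program -/

section Marginals

variable {A₀ B₀ A₁ B₁ : Type*}

/-- The marginal `X_{A₀B₀B₁}`. -/
def margA₀B₀B₁ [Fintype A₁] (X : Op ((A₀ × B₀) × (A₁ × B₁))) : Op ((A₀ × B₀) × B₁) :=
  Matrix.of fun p q => ∑ x, X (p.1, (x, p.2)) (q.1, (x, q.2))

/-- The marginal `X_{A₀A₁B₀}` (in the order `A₀ B₀ A₁`). -/
def margA₀A₁B₀ [Fintype B₁] (X : Op ((A₀ × B₀) × (A₁ × B₁))) : Op ((A₀ × B₀) × A₁) :=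
  Matrix.of fun p q => ∑ y, X (p.1, (p.2, y)) (q.1, (q.2, y))

/-- The marginal `X_{B₀B₁}`. -/
def margB₀B₁ [Fintype A₀] [Fintype A₁] (X : Op ((A₀ × B₀) × (A₁ × B₁))) : Op (B₀ × B₁) :=
  Matrix.of fun p q => ∑ w, ∑ x, X ((w, p.1), (x, p.2)) ((w, q.1), (x, q.2))

/-- The marginal `X_{A₀A₁}`. -/
def margA₀A₁ [Fintype B₀] [Fintype B₁] (X : Op ((A₀ × B₀) × (A₁ × B₁))) : Op (A₀ × A₁) :=
  Matrix.of fun p q => ∑ z, ∑ y, X ((p.1, z), (p.2, y)) ((q.1, z), (q.2, y))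

/-- Feasibility of `(m, V, W, X)` in the semidefinite program for the Choi operator `J`. The
`submatrix` only reorders the tensor factors. -/
structure SDPFeasible [Fintype A₀] [Fintype B₀] [Fintype A₁] [Fintype B₁]
    [DecidableEq A₀] [DecidableEq B₀]
    (J : Op ((A₀ × B₀) × (A₁ × B₁))) (m : ℝ) (V W X : Op ((A₀ × B₀) × (A₁ × B₁))) :
    Prop where
  V_ge : (V - J).PosSemidef
  W_ge : (W - J).PosSemidef
  X_ge : (X - J).PosSemidef
  X_nsA : margA₀B₀B₁ X = (maxMixed A₀ ⊗ₖ margB₀B₁ X).submatrix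
    (fun p => (p.1.1, (p.1.2, p.2))) (fun p => (p.1.1, (p.1.2, p.2)))
  X_nsB : margA₀A₁B₀ X = (maxMixed B₀ ⊗ₖ margA₀A₁ X).submatrix
    (fun p => (p.1.2, (p.1.1, p.2))) (fun p => (p.1.2, (p.1.1, p.2)))
  W_A₀B₀B₁ : (m : ℂ) • margA₀B₀B₁ J = margA₀B₀B₁ W
  X_V_A₀B₀B₁ : margA₀B₀B₁ X = margA₀B₀B₁ V
  V_A₀A₁B₀ : (m : ℂ) • margA₀A₁B₀ J = margA₀A₁B₀ V
  X_W_A₀A₁B₀ : margA₀A₁B₀ X = margA₀A₁B₀ W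

/-- The objective values `⌈m⌉` over all feasible points of the semidefinite program. -/
def sdpValues [Fintype A₀] [Fintype B₀] [Fintype A₁] [Fintype B₁]
    [DecidableEq A₀] [DecidableEq B₀] (N : LMap (A₀ × B₀) (A₁ × B₁)) : Set ℤ :=
  {c | ∃ (m : ℝ) (V W X : Op ((A₀ × B₀) × (A₁ × B₁))), SDPFeasible (choi N) m V W X ∧ c = ⌈m⌉}

end Marginals

/-! ### Point-to-point channels and the conditional min-entropy -/

/-- A map from `A` to `B`, regarded as a bipartite map from Alice's input `A` to Bob's output `B`
with one-dimensional systems as Bob's input and Alice's output. -/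
def pointToPoint {A B : Type*} (M : LMap A B) : LMap (A × Unit) (Unit × B) :=
  (Matrix.reindexLinearEquiv ℂ ℂ (Equiv.punitProd B).symm (Equiv.punitProd B).symm).toLinearMap ∘ₗ
    M ∘ₗ (Matrix.reindexLinearEquiv ℂ ℂ (Equiv.prodPUnit A) (Equiv.prodPUnit A)).toLinearMap

/-- The max-relative entropy `log₂ min {t | ρ ≤ t σ}` (`⊤` if there is no such `t`). -/
def maxRelEntropy {a : Type*} [Fintype a] (ρ σ : Op a) : EReal :=
  log2 (⨅ (t : ℝ≥0) (_ : (((t : ℝ) : ℂ) • σ - ρ).PosSemidef), (t : ℝ≥0∞))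

/-- The conditional min-entropy `H_min(A|B)_ρ = -min_σ D_max(ρ ‖ 1_A ⊗ σ_B)`, where `σ` ranges over
the density operators. -/
def condMinEntropy {a b : Type*} [Fintype a] [Fintype b] [DecidableEq a] (ρ : Op (a × b)) :
    EReal :=
  -⨅ (σ : Op b) (_ : σ.PosSemidef ∧ σ.trace = 1), maxRelEntropy ρ ((1 : Op a) ⊗ₖ σ)

end

end BiCost

namespace BiCost

set_option linter.unusedSectionVars false

/-! ### Choi operators -/

section Choi

variable {a b c d : Type*}

/-! Everything is read off Choi operators: a channel is a positive operator with identity input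
marginal, and conditions with replacement channels become equations between marginals.

Necessity. Apply the superchannel to every `shift c e`, not only to `noiseless n = shift 0 0`, and
let `T c e` be the resulting Choi operators. Replacing Alice's output averages over `c`, so
non-signalling makes the A₀B₀B₁ marginal of `T c e` independent of `c`; likewise the A₀A₁B₀ marginal
is independent of `e`. The sums of `T` over the row, the column and the diagonal through `(0, 0)`
are then feasible `V`, `W`, `X` at `m = n` (`IsNSSuperchannel.sdpFeasible`).

Sufficiency. A feasible point at `n` is turned back into an `n × n` table of channels, with `J` at
`(0, 0)` and equal shares of `V - J`, `W - J`, `X - J` elsewhere. `simulator` sends uniformly random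
messages through the given channel, reads off by which shifts the outputs differ from them, and
applies that entry of the table. On the noiseless channel both shifts vanish and `J` comes out
(`SDPFeasible.exists_isNSSuperchannel`).

Zero error is an infimum, so at first it only gives channels converging to `N`, each feasible at
`n`. The set of Choi operators feasible at `n` is closed, because `V`, `W`, `X` have fixed trace
(`isClosed_feasibleChoi`); hence `simError_noiseless_le_zero_iff`. Feasibility is monotone in `m`,
so the least feasible integer is the least `⌈m⌉`.

For a point-to-point channel the program collapses to `J ≤ 1 ⊗ Y` with `tr Y = m ≥ 1`. Writing `Y =
t σ` shows that the least trace is `2 ^ (-H_min)`. -/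

theorem apply_eq_sum_choi [Fintype a] [DecidableEq a] (Φ : LMap a b) (X : Op a) (p q : b) :
    Φ X p q = ∑ i, ∑ j, X i j * choi Φ (i, p) (j, q) := by
  conv_lhs => rw [Matrix.matrix_eq_sum_single X]
  simp only [map_sum, Matrix.sum_apply, choi, Matrix.of_apply]
  refine Finset.sum_congr rfl fun i _ => Finset.sum_congr rfl fun j _ => ?_
  have h : Matrix.single i j (X i j) = X i j • Matrix.single i j (1 : ℂ) := by
    simp [Matrix.smul_single]
  rw [h, map_smul]
  rfl

theorem choi_injective [Fintype a] [DecidableEq a] :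
    Function.Injective (choi : LMap a b → Op (a × b)) := by
  intro Φ Ψ h
  ext X p q
  rw [apply_eq_sum_choi, apply_eq_sum_choi, h]

/-- The linear map with a given Choi operator. -/
def ofChoi [Fintype a] (J : Op (a × b)) : LMap a b where
  toFun X := Matrix.of fun p q => ∑ i, ∑ j, X i j * J (i, p) (j, q)
  map_add' X Y := by
    ext p q
    simp [add_mul, Finset.sum_add_distrib]
  map_smul' c X := by
    ext p q
    simp [Finset.mul_sum, mul_assoc]

@[simp]
theorem choi_ofChoi [Fintype a] [DecidableEq a] (J : Op (a × b)) : choi (ofChoi J) = J := by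
  ext p q
  simp only [choi, ofChoi, Matrix.of_apply, LinearMap.coe_mk, AddHom.coe_mk]
  rw [Finset.sum_eq_single p.1, Finset.sum_eq_single q.1]
  · simp
  · intro j _ hj
    simp [hj.symm]
  · simp
  · intro i _ hi
    exact Finset.sum_eq_zero fun j _ => by simp [hi.symm]
  · simp

theorem choi_add [DecidableEq a] (Φ Ψ : LMap a b) : choi (Φ + Ψ) = choi Φ + choi Ψ := rfl

theorem choi_smul [DecidableEq a] (t : ℂ) (Φ : LMap a b) : choi (t • Φ) = t • choi Φ := rfl

theorem choi_sum [DecidableEq a] {ι : Type*} (s : Finset ι) (Φ : ι → LMap a b) :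
    choi (∑ i ∈ s, Φ i) = ∑ i ∈ s, choi (Φ i) := by
  ext p q
  simp [choi, Matrix.sum_apply]

/-- Contracting a tensor factor with the all-ones vector preserves positivity. -/
theorem posSemidef_sum_blocks [Fintype a] [Fintype b] {M : Op (a × b)} (hM : M.PosSemidef) :
    (Matrix.of fun p q => ∑ i, ∑ j, M (p, i) (q, j) : Op a).PosSemidef := by
  classical
  convert hM.conjTranspose_mul_mul_same
    (Matrix.of fun x p => if x.1 = p then 1 else 0 : Matrix (a × b) a ℂ) using 1
  ext p q
  simp only [Matrix.of_apply, Matrix.mul_apply, Matrix.conjTranspose_apply, Fintype.sum_prod_type]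
  rw [Finset.sum_eq_single q]
  · simp only [if_true, mul_one]
    rw [Finset.sum_comm]
    refine Finset.sum_congr rfl fun j _ => ?_
    rw [Finset.sum_eq_single p]
    · simp
    · intro x _ hx
      simp [hx]
    · simp
  · intro x _ hx
    simp [hx]
  · simp

theorem posSemidef_kronecker [Fintype a] [Fintype b] {M : Op a} {N : Op b} (hM : M.PosSemidef)
    (hN : N.PosSemidef) : (M ⊗ₖ N).PosSemidef :=
  hM.kronecker hN

/-- The output is `X ⊗ choi Φ` contracted with the unnormalised maximally entangled vector on the
two copies of the input. -/
theorem posSemidef_idTensor_of_choi [Fintype a] [Fintype b] [DecidableEq a] {r : Type*} [Fintype r]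
    {Φ : LMap a b} (h : (choi Φ).PosSemidef) {X : Op (r × a)} (hX : X.PosSemidef) :
    (idTensor r Φ X).PosSemidef := by
  have := posSemidef_sum_blocks (a := r × b) (b := a)
    ((posSemidef_kronecker hX h).submatrix fun x : (r × b) × a => ((x.1.1, x.2), (x.2, x.1.2)))
  convert this using 1
  ext p q
  simp [idTensor, apply_eq_sum_choi Φ]

theorem posSemidef_choi [Fintype a] [Fintype b] [DecidableEq a] {Φ : LMap a b}
    (h : ∀ (r : ℕ) (X : Op (Fin r × a)), X.PosSemidef → (idTensor (Fin r) Φ X).PosSemidef) :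
    (choi Φ).PosSemidef := by
  let e := Fintype.equivFin a
  -- The unnormalised maximally entangled vector; `e` is needed because references are indexed by
  -- `Fin r`.
  let v : Fin (Fintype.card a) × a → ℂ := fun x => if x.1 = e x.2 then 1 else 0
  have h1 := (h _ _ (Matrix.posSemidef_vecMulVec_self_star v)).submatrix
    fun x : a × b => (e x.1, x.2)
  convert h1 using 1
  ext p q
  simp only [choi, idTensor, Matrix.of_apply, Matrix.submatrix_apply, LinearMap.coe_mk,
    AddHom.coe_mk]
  refine congrArg (fun Y => Φ Y p.2 q.2) ?_
  ext i j
  simp only [v, Matrix.single_apply, Matrix.submatrix_apply, Matrix.vecMulVec_apply, Pi.star_apply,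
    EmbeddingLike.apply_eq_iff_eq]
  by_cases h1 : p.1 = i <;> by_cases h2 : q.1 = j <;> simp [h1, h2]

theorem isChannel_iff [Fintype a] [Fintype b] [DecidableEq a] {Φ : LMap a b} :
    IsChannel Φ ↔ (choi Φ).PosSemidef ∧
      ∀ i j, ∑ x, choi Φ (i, x) (j, x) = (1 : Op a) i j := by
  constructor
  · refine fun h => ⟨posSemidef_choi h.completelyPositive, fun i j => ?_⟩
    have := h.tracePreserving (Matrix.single i j 1)
    have h1 : (Matrix.single i j (1 : ℂ)).trace = (1 : Op a) i j := by
      by_cases hij : i = j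
      · subst hij
        simp
      · simp [hij, Matrix.trace_single_eq_of_ne]
    exact this.trans h1
  · rintro ⟨h1, h2⟩
    refine ⟨fun r X hX => posSemidef_idTensor_of_choi h1 hX, fun X => ?_⟩
    simp only [Matrix.trace, Matrix.diag_apply, apply_eq_sum_choi Φ]
    rw [Finset.sum_comm]
    refine Finset.sum_congr rfl fun i _ => ?_
    rw [Finset.sum_comm]
    simp only [← Finset.mul_sum, h2]
    simp [Matrix.one_apply]

theorem IsChannel.posSemidef [Fintype a] [Fintype b] [DecidableEq a] {Φ : LMap a b}
    (h : IsChannel Φ) : (choi Φ).PosSemidef :=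
  (isChannel_iff.1 h).1

theorem IsChannel.sum_choi [Fintype a] [Fintype b] [DecidableEq a] {Φ : LMap a b}
    (h : IsChannel Φ) (i j : a) : ∑ x, choi Φ (i, x) (j, x) = (1 : Op a) i j :=
  (isChannel_iff.1 h).2 i j

theorem choi_idTensorSuper [Fintype a] [DecidableEq c] {r₀ r₁ : Type*} [Fintype r₀]
    [DecidableEq r₀] (Θ : SuperMap a b c d) (N : LMap (r₀ × a) (r₁ × b))
    (i j : r₀) (p q : r₁) (s s' : c) (t t' : d) :
    choi (idTensorSuper Θ N) ((i, s), (p, t)) ((j, s'), (q, t')) =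
      choi (Θ (slice N i j p q)) (s, t) (s', t') := by
  have key : ∀ i' j', (Matrix.single (i, s) (j, s') (1 : ℂ)).submatrix (Prod.mk i') (Prod.mk j') =
      if i' = i ∧ j' = j then Matrix.single s s' (1 : ℂ) else 0 := by
    intro i' j'
    ext x y
    by_cases h : i' = i ∧ j' = j
    · simp [h.1, h.2, Matrix.single_apply]
    · rw [if_neg h]
      simp only [Matrix.submatrix_apply, Matrix.single_apply, Prod.mk.injEq, Matrix.zero_apply]
      exact if_neg fun h' => h ⟨h'.1.1.symm, h'.2.1.symm⟩
  simp only [choi, idTensorSuper, Matrix.of_apply, LinearMap.coe_mk, AddHom.coe_mk, key]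
  rw [Finset.sum_eq_single i, Finset.sum_eq_single j]
  · simp
  · intro j' _ hj
    simp [hj]
  · simp
  · intro i' _ hi
    exact Finset.sum_eq_zero fun j' _ => by simp [hi]
  · simp

theorem choi_slice [DecidableEq a] {r₀ r₁ : Type*} [DecidableEq r₀]
    (N : LMap (r₀ × a) (r₁ × b)) (i j : r₀) (p q : r₁) (s s' : a) (t t' : b) :
    choi (slice N i j p q) (s, t) (s', t') = choi N ((i, s), (p, t)) ((j, s'), (q, t')) := by
  simp [choi, slice, Matrix.single_kronecker_single]

theorem IsSuperchannel.isChannel [Fintype a] [Fintype b] [Fintype c] [Fintype d]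
    {Θ : SuperMap a b c d} (hΘ : IsSuperchannel Θ)
    {N : LMap a b} (hN : IsChannel N) : IsChannel (Θ N) := by
  classical
  -- `N` with one-dimensional reference systems; its only slice is `N` itself.
  let N' : LMap (Fin 1 × a) (Fin 1 × b) :=
    ofChoi ((choi N).submatrix (fun x => (x.1.2, x.2.2)) (fun x => (x.1.2, x.2.2)))
  have hN' : IsChannel N' := by
    rw [isChannel_iff, choi_ofChoi]
    refine ⟨hN.posSemidef.submatrix _, ?_⟩
    rintro ⟨i, s⟩ ⟨j, s'⟩
    have := hN.sum_choi s s'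
    simpa [Fintype.sum_prod_type, Matrix.one_apply, Subsingleton.elim i j] using this
  have hs : slice N' 0 0 0 0 = N := by
    apply choi_injective
    ext ⟨s, t⟩ ⟨s', t'⟩
    rw [choi_slice, choi_ofChoi]
    rfl
  have h := isChannel_iff.1 (hΘ 1 1 N' hN')
  rw [isChannel_iff]
  refine ⟨?_, fun s s' => ?_⟩
  · convert h.1.submatrix fun x : c × d => ((0, x.1), (0, x.2)) using 1
    ext ⟨s, t⟩ ⟨s', t'⟩
    rw [Matrix.submatrix_apply, choi_idTensorSuper, hs]
  · have h2 := h.2 (0, s) (0, s')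
    simpa [Fintype.sum_prod_type, choi_idTensorSuper, hs, Matrix.one_apply] using h2

end Choi

/-! ### Marginals and replacement channels -/

section Marginals

variable {A₀ B₀ A₁ B₁ ι : Type*}

section Linearity

theorem margA₀B₀B₁_add [Fintype A₁] (X Y : Op ((A₀ × B₀) × (A₁ × B₁))) :
    margA₀B₀B₁ (X + Y) = margA₀B₀B₁ X + margA₀B₀B₁ Y := by
  ext p q
  simp [margA₀B₀B₁, Finset.sum_add_distrib]

theorem margA₀A₁B₀_add [Fintype B₁] (X Y : Op ((A₀ × B₀) × (A₁ × B₁))) :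
    margA₀A₁B₀ (X + Y) = margA₀A₁B₀ X + margA₀A₁B₀ Y := by
  ext p q
  simp [margA₀A₁B₀, Finset.sum_add_distrib]

theorem margA₀B₀B₁_sub [Fintype A₁] (X Y : Op ((A₀ × B₀) × (A₁ × B₁))) :
    margA₀B₀B₁ (X - Y) = margA₀B₀B₁ X - margA₀B₀B₁ Y := by
  ext p q
  simp [margA₀B₀B₁]

theorem margA₀A₁B₀_sub [Fintype B₁] (X Y : Op ((A₀ × B₀) × (A₁ × B₁))) :
    margA₀A₁B₀ (X - Y) = margA₀A₁B₀ X - margA₀A₁B₀ Y := by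
  ext p q
  simp [margA₀A₁B₀]

theorem margA₀B₀B₁_smul [Fintype A₁] (t : ℂ) (X : Op ((A₀ × B₀) × (A₁ × B₁))) :
    margA₀B₀B₁ (t • X) = t • margA₀B₀B₁ X := by
  ext p q
  simp [margA₀B₀B₁, Finset.mul_sum]

theorem margA₀A₁B₀_smul [Fintype B₁] (t : ℂ) (X : Op ((A₀ × B₀) × (A₁ × B₁))) :
    margA₀A₁B₀ (t • X) = t • margA₀A₁B₀ X := by
  ext p q
  simp [margA₀A₁B₀, Finset.mul_sum]

theorem margA₀B₀B₁_sum [Fintype A₁] (s : Finset ι) (X : ι → Op ((A₀ × B₀) × (A₁ × B₁))) :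
    margA₀B₀B₁ (∑ i ∈ s, X i) = ∑ i ∈ s, margA₀B₀B₁ (X i) := by
  ext p q
  simp only [margA₀B₀B₁, Matrix.of_apply, Matrix.sum_apply]
  exact Finset.sum_comm

theorem margA₀A₁B₀_sum [Fintype B₁] (s : Finset ι) (X : ι → Op ((A₀ × B₀) × (A₁ × B₁))) :
    margA₀A₁B₀ (∑ i ∈ s, X i) = ∑ i ∈ s, margA₀A₁B₀ (X i) := by
  ext p q
  simp only [margA₀A₁B₀, Matrix.of_apply, Matrix.sum_apply]
  exact Finset.sum_comm

end Linearity

variable [Fintype A₀] [Fintype B₀] [Fintype A₁] [Fintype B₁]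

theorem posSemidef_margA₀B₀B₁ {X : Op ((A₀ × B₀) × (A₁ × B₁))} (hX : X.PosSemidef) :
    (margA₀B₀B₁ X).PosSemidef := by
  convert Matrix.posSemidef_sum Finset.univ fun (x : A₁) _ =>
    hX.submatrix fun p : (A₀ × B₀) × B₁ => (p.1, (x, p.2)) using 1
  ext p q
  simp [margA₀B₀B₁, Matrix.sum_apply]

theorem posSemidef_margA₀A₁B₀ {X : Op ((A₀ × B₀) × (A₁ × B₁))} (hX : X.PosSemidef) :
    (margA₀A₁B₀ X).PosSemidef := by
  convert Matrix.posSemidef_sum Finset.univ fun (y : B₁) _ =>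
    hX.submatrix fun p : (A₀ × B₀) × A₁ => (p.1, (p.2, y)) using 1
  ext p q
  simp [margA₀A₁B₀, Matrix.sum_apply]

variable [DecidableEq A₀] [DecidableEq B₀] [DecidableEq A₁] [DecidableEq B₁]

/-- The marginal on `A₀B₀B₁` is non-signalling from `A` to `B`. -/
def IsNonsignallingA (X : Op ((A₀ × B₀) × (A₁ × B₁))) : Prop :=
  margA₀B₀B₁ X = (maxMixed A₀ ⊗ₖ margB₀B₁ X).submatrix
    (fun p => (p.1.1, (p.1.2, p.2))) (fun p => (p.1.1, (p.1.2, p.2)))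

/-- The marginal on `A₀A₁B₀` is non-signalling from `B` to `A`. -/
def IsNonsignallingB (X : Op ((A₀ × B₀) × (A₁ × B₁))) : Prop :=
  margA₀A₁B₀ X = (maxMixed B₀ ⊗ₖ margA₀A₁ X).submatrix
    (fun p => (p.1.2, (p.1.1, p.2))) (fun p => (p.1.2, (p.1.1, p.2)))

/-- The operator `Z_{A₀B₀B₁} ↦ π_{A₀} ⊗ Z_{B₀B₁}`. -/
noncomputable def mixA₀ (Z : Op ((A₀ × B₀) × B₁)) : Op ((A₀ × B₀) × B₁) :=
  Matrix.of fun p q => maxMixed A₀ p.1.1 q.1.1 * ∑ w, Z ((w, p.1.2), p.2) ((w, q.1.2), q.2)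

/-- The operator `Z_{A₀A₁B₀} ↦ π_{B₀} ⊗ Z_{A₀A₁}`. -/
noncomputable def mixB₀ (Z : Op ((A₀ × B₀) × A₁)) : Op ((A₀ × B₀) × A₁) :=
  Matrix.of fun p q => maxMixed B₀ p.1.2 q.1.2 * ∑ z, Z ((p.1.1, z), p.2) ((q.1.1, z), q.2)

/-- As a fixed-point equation for one marginal, the condition passes between operators with that
marginal in common, and it is visibly linear and closed. -/
theorem isNonsignallingA_iff {X : Op ((A₀ × B₀) × (A₁ × B₁))} :
    IsNonsignallingA X ↔ margA₀B₀B₁ X = mixA₀ (margA₀B₀B₁ X) :=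
  Iff.rfl

theorem isNonsignallingB_iff {X : Op ((A₀ × B₀) × (A₁ × B₁))} :
    IsNonsignallingB X ↔ margA₀A₁B₀ X = mixB₀ (margA₀A₁B₀ X) :=
  Iff.rfl

theorem choi_replaceFst_comp (Φ : LMap (A₀ × B₀) (A₁ × B₁)) (p q : A₀ × B₀) (x x' : A₁)
    (y y' : B₁) : choi (replaceFst A₁ B₁ ∘ₗ Φ) (p, (x, y)) (q, (x', y')) =
      maxMixed A₁ x x' * margA₀B₀B₁ (choi Φ) (p, y) (q, y') :=
  rfl

theorem choi_replaceSnd_comp (Φ : LMap (A₀ × B₀) (A₁ × B₁)) (p q : A₀ × B₀) (x x' : A₁)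
    (y y' : B₁) : choi (replaceSnd A₁ B₁ ∘ₗ Φ) (p, (x, y)) (q, (x', y')) =
      margA₀A₁B₀ (choi Φ) (p, x) (q, x') * maxMixed B₁ y y' :=
  rfl

theorem maxMixed_apply_self_ne_zero (a : Type*) [Fintype a] [DecidableEq a] (x : a) :
    maxMixed a x x ≠ 0 := by
  have : Nonempty a := ⟨x⟩
  simp [maxMixed]

/-- The factor `π` has nonzero diagonal entries and can be cancelled: replacing Alice's output
forgets her output system and nothing else. -/
theorem replaceFst_comp_eq_iff [Nonempty A₁] {Φ Ψ : LMap (A₀ × B₀) (A₁ × B₁)} :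
    replaceFst A₁ B₁ ∘ₗ Φ = replaceFst A₁ B₁ ∘ₗ Ψ ↔
      margA₀B₀B₁ (choi Φ) = margA₀B₀B₁ (choi Ψ) := by
  constructor
  · intro h
    ext ⟨p, y⟩ ⟨q, y'⟩
    obtain ⟨x⟩ := ‹Nonempty A₁›
    have h1 := congrFun (congrFun (congrArg choi h) (p, (x, y))) (q, (x, y'))
    rw [choi_replaceFst_comp, choi_replaceFst_comp] at h1
    exact mul_left_cancel₀ (maxMixed_apply_self_ne_zero A₁ x) h1
  · intro h
    apply choi_injective
    ext ⟨p, x, y⟩ ⟨q, x', y'⟩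
    rw [choi_replaceFst_comp, choi_replaceFst_comp, h]

theorem replaceSnd_comp_eq_iff [Nonempty B₁] {Φ Ψ : LMap (A₀ × B₀) (A₁ × B₁)} :
    replaceSnd A₁ B₁ ∘ₗ Φ = replaceSnd A₁ B₁ ∘ₗ Ψ ↔
      margA₀A₁B₀ (choi Φ) = margA₀A₁B₀ (choi Ψ) := by
  constructor
  · intro h
    ext ⟨p, x⟩ ⟨q, x'⟩
    obtain ⟨y⟩ := ‹Nonempty B₁›
    have h1 := congrFun (congrFun (congrArg choi h) (p, (x, y))) (q, (x', y))
    rw [choi_replaceSnd_comp, choi_replaceSnd_comp] at h1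
    exact mul_right_cancel₀ (maxMixed_apply_self_ne_zero B₁ y) h1
  · intro h
    apply choi_injective
    ext ⟨p, x, y⟩ ⟨q, x', y'⟩
    rw [choi_replaceSnd_comp, choi_replaceSnd_comp, h]

theorem replaceFst_single (w w' : A₀) (b b' : B₀) :
    replaceFst A₀ B₀ (Matrix.single (w, b) (w', b') 1) =
      maxMixed A₀ w w' • ∑ z, Matrix.single (z, b) (z, b') (1 : ℂ) := by
  ext ⟨u, c⟩ ⟨u', c'⟩
  simp only [replaceFst, LinearMap.coe_mk, AddHom.coe_mk, Matrix.kroneckerMap_apply, maxMixed,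
    Matrix.smul_apply, Matrix.one_apply, smul_eq_mul, Matrix.of_apply, Matrix.sum_apply,
    Matrix.single_apply, Prod.mk.injEq]
  by_cases hb : b = c ∧ b' = c'
  · by_cases hw : w = w' <;> by_cases hu : u = u' <;> simp [hb, hw, hu]
    exact Or.inr (Ne.symm hw)
  · have h1 : ∀ x, ¬ ((w = x ∧ b = c) ∧ w' = x ∧ b' = c') := fun x h => hb ⟨h.1.2, h.2.2⟩
    have h2 : ∀ z, ¬ ((z = u ∧ b = c) ∧ z = u' ∧ b' = c') := fun x h => hb ⟨h.1.2, h.2.2⟩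
    simp [h1, h2]

theorem replaceSnd_single (w w' : A₀) (b b' : B₀) :
    replaceSnd A₀ B₀ (Matrix.single (w, b) (w', b') 1) =
      maxMixed B₀ b b' • ∑ z, Matrix.single (w, z) (w', z) (1 : ℂ) := by
  ext ⟨u, c⟩ ⟨u', c'⟩
  simp only [replaceSnd, LinearMap.coe_mk, AddHom.coe_mk, Matrix.kroneckerMap_apply, maxMixed,
    Matrix.smul_apply, Matrix.one_apply, smul_eq_mul, Matrix.of_apply, Matrix.sum_apply,
    Matrix.single_apply, Prod.mk.injEq]
  by_cases hb : w = u ∧ w' = u'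
  · by_cases hw : b = b' <;> by_cases hu : c = c' <;> simp [hb, hw, hu]
    exact Or.inl (Ne.symm hw)
  · have h1 : ∀ x, ¬ ((w = u ∧ b = x) ∧ w' = u' ∧ b' = x) := fun x h => hb ⟨h.1.1, h.2.1⟩
    have h2 : ∀ z, ¬ ((w = u ∧ z = c) ∧ w' = u' ∧ z = c') := fun x h => hb ⟨h.1.1, h.2.1⟩
    simp [h1, h2]

theorem margA₀B₀B₁_choi_comp_replaceFst (Φ : LMap (A₀ × B₀) (A₁ × B₁)) :
    margA₀B₀B₁ (choi (Φ ∘ₗ replaceFst A₀ B₀)) = mixA₀ (margA₀B₀B₁ (choi Φ)) := by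
  ext ⟨⟨w, b⟩, y⟩ ⟨⟨w', b'⟩, y'⟩
  simp only [margA₀B₀B₁, choi, Matrix.of_apply, LinearMap.comp_apply, replaceFst_single, map_smul,
    map_sum, Matrix.smul_apply, Matrix.sum_apply, mixA₀, smul_eq_mul, ← Finset.mul_sum]
  rw [Finset.sum_comm]

theorem margA₀A₁B₀_choi_comp_replaceSnd (Φ : LMap (A₀ × B₀) (A₁ × B₁)) :
    margA₀A₁B₀ (choi (Φ ∘ₗ replaceSnd A₀ B₀)) = mixB₀ (margA₀A₁B₀ (choi Φ)) := by
  ext ⟨⟨w, b⟩, y⟩ ⟨⟨w', b'⟩, y'⟩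
  simp only [margA₀A₁B₀, choi, Matrix.of_apply, LinearMap.comp_apply, replaceSnd_single, map_smul,
    map_sum, Matrix.smul_apply, Matrix.sum_apply, mixB₀, smul_eq_mul, ← Finset.mul_sum]
  rw [Finset.sum_comm]

/-- Translates `alice_input` into the constraint `X_nsA` of the program. -/
theorem replaceFst_comp_replaceFst_eq_iff [Nonempty A₁] {Φ : LMap (A₀ × B₀) (A₁ × B₁)} :
    replaceFst A₁ B₁ ∘ₗ Φ ∘ₗ replaceFst A₀ B₀ = replaceFst A₁ B₁ ∘ₗ Φ ↔
      IsNonsignallingA (choi Φ) := by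
  rw [replaceFst_comp_eq_iff, margA₀B₀B₁_choi_comp_replaceFst, isNonsignallingA_iff, eq_comm]

theorem replaceSnd_comp_replaceSnd_eq_iff [Nonempty B₁] {Φ : LMap (A₀ × B₀) (A₁ × B₁)} :
    replaceSnd A₁ B₁ ∘ₗ Φ ∘ₗ replaceSnd A₀ B₀ = replaceSnd A₁ B₁ ∘ₗ Φ ↔
      IsNonsignallingB (choi Φ) := by
  rw [replaceSnd_comp_eq_iff, margA₀A₁B₀_choi_comp_replaceSnd, isNonsignallingB_iff, eq_comm]

end Marginals

/-! ### Shifted classical channels and necessity of the program -/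

section Shift

variable {n : ℕ} [NeZero n]

/-- The bidirectional classical channel whose outputs are shifted by `c` for Alice and by `e`
for Bob, `|k l⟩ ↦ |l + c, k + e⟩`. -/
def shift (c e : Fin n) : LMap (Fin n × Fin n) (Fin n × Fin n) where
  toFun X := Matrix.diagonal fun p => X (p.2 - e, p.1 - c) (p.2 - e, p.1 - c)
  map_add' X Y := by
    rw [Matrix.diagonal_add]
    rfl
  map_smul' t X := by
    rw [RingHom.id_apply, ← Matrix.diagonal_smul]
    rfl

theorem shift_apply (c e : Fin n) (X : Op (Fin n × Fin n)) :
    shift c e X = Matrix.diagonal fun p => X (p.2 - e, p.1 - c) (p.2 - e, p.1 - c) :=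
  rfl

theorem noiseless_eq_shift : noiseless n = shift (0 : Fin n) 0 := by
  ext X ⟨x, y⟩ ⟨x', y'⟩
  simp only [noiseless, LinearMap.coe_mk, AddHom.coe_mk, Matrix.sum_apply, shift_apply,
    Matrix.single_apply, Matrix.diagonal_apply, sub_zero, Prod.mk.injEq]
  rw [Finset.sum_eq_single y, Finset.sum_eq_single x]
  · simp
  · intro l _ hl
    simp [hl]
  · simp
  · intro k _ hk
    exact Finset.sum_eq_zero fun l _ => by simp [hk]
  · simp

theorem isChannel_shift (c e : Fin n) : IsChannel (shift c e) := by
  have h : choi (shift c e) = Matrix.diagonal fun p : (Fin n × Fin n) × (Fin n × Fin n) =>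
      if p.1 = (p.2.2 - e, p.2.1 - c) then (1 : ℂ) else 0 := by
    ext ⟨i, p⟩ ⟨j, q⟩
    simp only [choi, Matrix.of_apply, shift_apply, Matrix.diagonal_apply, Matrix.single_apply]
    by_cases hpq : p = q
    · subst hpq
      by_cases hij : i = j
      · simp [hij]
      · have : ¬ (i = (p.2 - e, p.1 - c) ∧ j = (p.2 - e, p.1 - c)) :=
          fun h => hij (h.1.trans h.2.symm)
        simp [hij, this]
    · simp [hpq]
  rw [isChannel_iff]
  constructor
  · rw [h, Matrix.posSemidef_diagonal_iff]
    intro p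
    split_ifs
    · exact zero_le_one
    · exact le_rfl
  · intro i j
    by_cases hij : i = j
    · subst hij
      rw [h, Finset.sum_eq_single (i.2 + c, i.1 + e)]
      · simp
      · intro x _ hx
        rw [Matrix.diagonal_apply_eq, if_neg]
        intro hi
        apply hx
        change i = (x.2 - e, x.1 - c) at hi
        rw [hi]
        simp
      · simp
    · rw [Matrix.one_apply_ne hij, h]
      exact Finset.sum_eq_zero fun x _ => Matrix.diagonal_apply_ne _ fun h => hij (congrArg Prod.fst h)

/-- A uniform output for Alice is the average over all her shifts. What matters later is that the
right side does not involve `c`. -/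
theorem replaceFst_comp_shift (c e : Fin n) :
    replaceFst (Fin n) (Fin n) ∘ₗ shift c e = (n : ℂ)⁻¹ • ∑ c', shift c' e := by
  ext X ⟨x, y⟩ ⟨x', y'⟩
  simp only [replaceFst, LinearMap.comp_apply, LinearMap.coe_mk, AddHom.coe_mk,
    Matrix.kroneckerMap_apply, maxMixed, Fintype.card_fin, Matrix.smul_apply, Matrix.one_apply,
    smul_eq_mul, Matrix.of_apply, LinearMap.smul_apply, LinearMap.sum_apply, Matrix.sum_apply,
    shift_apply, Matrix.diagonal_apply, Prod.mk.injEq, true_and]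
  by_cases hx : x = x'
  · by_cases hy : y = y'
    · simp only [hx, hy, if_true, mul_one, true_and]
      congr 1
      exact ((Equiv.subRight c).sum_comp fun z => X (y' - e, z) (y' - e, z)).trans
        ((Equiv.subLeft x').sum_comp fun z => X (y' - e, z) (y' - e, z)).symm
    · simp [hy]
  · simp [hx]

theorem replaceSnd_comp_shift (c e : Fin n) :
    replaceSnd (Fin n) (Fin n) ∘ₗ shift c e = (n : ℂ)⁻¹ • ∑ e', shift c e' := by
  ext X ⟨x, y⟩ ⟨x', y'⟩
  simp only [replaceSnd, LinearMap.comp_apply, LinearMap.coe_mk, AddHom.coe_mk,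
    Matrix.kroneckerMap_apply, maxMixed, Fintype.card_fin, Matrix.smul_apply, Matrix.one_apply,
    smul_eq_mul, Matrix.of_apply, LinearMap.smul_apply, LinearMap.sum_apply, Matrix.sum_apply,
    shift_apply, Matrix.diagonal_apply, Prod.mk.injEq, and_true]
  by_cases hy : y = y'
  · by_cases hx : x = x'
    · simp only [hx, hy, if_true, mul_one, true_and]
      rw [mul_comm]
      congr 1
      exact ((Equiv.subRight e).sum_comp fun z => X (z, x' - c) (z, x' - c)).trans
        ((Equiv.subLeft y').sum_comp fun z => X (z, x' - c) (z, x' - c)).symm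
    · simp [hx]
  · simp [hy]

/-- Summing over `e` makes Bob's output uniform, and Alice's output carries only Bob's message, so
Alice's input has no influence left. -/
theorem sum_shift_comp_replaceFst (c : Fin n) :
    (∑ e, shift c e) ∘ₗ replaceFst (Fin n) (Fin n) = ∑ e, shift c e := by
  have hn : (n : ℂ) ≠ 0 := Nat.cast_ne_zero.2 (NeZero.ne n)
  ext X p q
  simp only [replaceFst, LinearMap.comp_apply, LinearMap.coe_mk, AddHom.coe_mk,
    maxMixed, Fintype.card_fin, LinearMap.sum_apply, Matrix.sum_apply,
    shift_apply, Matrix.diagonal_apply, Matrix.kroneckerMap_apply, Matrix.smul_apply,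
    Matrix.one_apply_eq, smul_eq_mul, mul_one, Matrix.of_apply]
  by_cases h : p = q
  · simp only [h, if_true, Finset.sum_const, Finset.card_univ, Fintype.card_fin, nsmul_eq_mul]
    rw [mul_inv_cancel_left₀ hn]
    exact ((Equiv.subLeft q.2).sum_comp fun z => X (z, q.1 - c) (z, q.1 - c)).symm
  · simp [h]

theorem sum_shift_comp_replaceSnd (e : Fin n) :
    (∑ c, shift c e) ∘ₗ replaceSnd (Fin n) (Fin n) = ∑ c, shift c e := by
  have hn : (n : ℂ) ≠ 0 := Nat.cast_ne_zero.2 (NeZero.ne n)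
  ext X p q
  simp only [replaceSnd, LinearMap.comp_apply, LinearMap.coe_mk, AddHom.coe_mk,
    maxMixed, Fintype.card_fin, LinearMap.sum_apply, Matrix.sum_apply,
    shift_apply, Matrix.diagonal_apply, Matrix.kroneckerMap_apply, Matrix.smul_apply,
    Matrix.one_apply_eq, smul_eq_mul, mul_one, Matrix.of_apply]
  by_cases h : p = q
  · simp only [h, if_true, Finset.sum_const, Finset.card_univ, Fintype.card_fin, nsmul_eq_mul]
    rw [mul_comm (∑ _, _) (n : ℂ)⁻¹, mul_inv_cancel_left₀ hn]
    exact ((Equiv.subLeft q.1).sum_comp fun z => X (q.2 - e, z) (q.2 - e, z)).symm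
  · simp [h]

end Shift

/-! ### Necessity: feasible points from non-signalling superchannels -/

section Necessity

variable {A₀ B₀ A₁ B₁ : Type*} [Fintype A₀] [Fintype B₀] [Fintype A₁] [Fintype B₁]
  [DecidableEq A₀] [DecidableEq B₀] [DecidableEq A₁] [DecidableEq B₁] [Nonempty A₁] [Nonempty B₁]
  {n : ℕ} [NeZero n]
  {Θ : SuperMap (Fin n × Fin n) (Fin n × Fin n) (A₀ × B₀) (A₁ × B₁)}

theorem margA₀B₀B₁_choi_shift_eq (hΘ : IsNSSuperchannel Θ) (c c' e : Fin n) :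
    margA₀B₀B₁ (choi (Θ (shift c e))) = margA₀B₀B₁ (choi (Θ (shift c' e))) := by
  rw [← replaceFst_comp_eq_iff, ← hΘ.alice_output, ← hΘ.alice_output (shift c' e),
    replaceFst_comp_shift, replaceFst_comp_shift]

theorem margA₀A₁B₀_choi_shift_eq (hΘ : IsNSSuperchannel Θ) (c e e' : Fin n) :
    margA₀A₁B₀ (choi (Θ (shift c e))) = margA₀A₁B₀ (choi (Θ (shift c e'))) := by
  rw [← replaceSnd_comp_eq_iff, ← hΘ.bob_output, ← hΘ.bob_output (shift c e'),
    replaceSnd_comp_shift, replaceSnd_comp_shift]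

theorem posSemidef_sum_sub {ι a : Type*} [Fintype ι] [DecidableEq ι] [Fintype a]
    {T : ι → Op a} (hT : ∀ i, (T i).PosSemidef) (i : ι) : ((∑ j, T j) - T i).PosSemidef := by
  rw [← Finset.sum_erase_eq_sub (Finset.mem_univ i)]
  exact Matrix.posSemidef_sum _ fun j _ => hT j

/-- What a non-signalling superchannel makes out of `n` noiseless messages is feasible at `n`. -/
theorem IsNSSuperchannel.sdpFeasible (hΘ : IsNSSuperchannel Θ) :
    SDPFeasible (choi (Θ (noiseless n))) n (∑ e, choi (Θ (shift 0 e)))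
      (∑ c, choi (Θ (shift c 0))) (∑ c, choi (Θ (shift c c))) := by
  have hT : ∀ c e : Fin n, (choi (Θ (shift c e))).PosSemidef := fun c e =>
    (hΘ.isSuperchannel.isChannel (isChannel_shift c e)).posSemidef
  -- Termwise, moving the diagonal entry `(c, c)` to `(0, c)` leaves this marginal unchanged.
  have hXV : margA₀B₀B₁ (∑ c, choi (Θ (shift c c))) =
      margA₀B₀B₁ (∑ e, choi (Θ (shift (0 : Fin n) e))) := by
    rw [margA₀B₀B₁_sum, margA₀B₀B₁_sum]
    exact Finset.sum_congr rfl fun c _ => margA₀B₀B₁_choi_shift_eq hΘ c 0 c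
  have hXW : margA₀A₁B₀ (∑ c, choi (Θ (shift c c))) =
      margA₀A₁B₀ (∑ c, choi (Θ (shift c (0 : Fin n)))) := by
    rw [margA₀A₁B₀_sum, margA₀A₁B₀_sum]
    exact Finset.sum_congr rfl fun c _ => margA₀A₁B₀_choi_shift_eq hΘ c c 0
  rw [noiseless_eq_shift]
  -- The `(0, 0)` entry is a summand of the row, of the column and of the diagonal, which gives the
  -- three operator inequalities.
  refine ⟨posSemidef_sum_sub (hT 0) 0, posSemidef_sum_sub (fun c => hT c 0) 0,
    posSemidef_sum_sub (fun c => hT c c) 0, ?_, ?_, ?_, hXV, ?_, hXW⟩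
  · refine isNonsignallingA_iff.2 ?_
    rw [hXV, ← choi_sum, ← map_sum]
    have h := hΘ.alice_input (∑ e, shift 0 e)
    rw [sum_shift_comp_replaceFst] at h
    exact isNonsignallingA_iff.1 (replaceFst_comp_replaceFst_eq_iff.1 h)
  · refine isNonsignallingB_iff.2 ?_
    rw [hXW, ← choi_sum, ← map_sum]
    have h := hΘ.bob_input (∑ c, shift c 0)
    rw [sum_shift_comp_replaceSnd] at h
    exact isNonsignallingB_iff.1 (replaceSnd_comp_replaceSnd_eq_iff.1 h)
  · rw [margA₀B₀B₁_sum, Finset.sum_congr rfl fun c _ => margA₀B₀B₁_choi_shift_eq hΘ c 0 0]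
    simp [Nat.cast_smul_eq_nsmul]
  · rw [margA₀A₁B₀_sum, Finset.sum_congr rfl fun e _ => margA₀A₁B₀_choi_shift_eq hΘ 0 e 0]
    simp [Nat.cast_smul_eq_nsmul]

end Necessity

/-! ### Superchannels that simulate by a family of channels -/

section Simulator

variable {A₀ B₀ A₁ B₁ : Type*} [Fintype A₀] [Fintype B₀] [Fintype A₁] [Fintype B₁]
  [DecidableEq A₀] [DecidableEq B₀] [DecidableEq A₁] [DecidableEq B₁]
  {n : ℕ} [NeZero n]

/-- The average weight of the outputs that are shifted by `c` for Alice and by `e` for Bob. -/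
noncomputable def shiftWeight (c e : Fin n) (F : LMap (Fin n × Fin n) (Fin n × Fin n)) : ℂ :=
  ((n : ℂ) ^ 2)⁻¹ * ∑ k, ∑ l, choi F ((k, l), (l + c, k + e)) ((k, l), (l + c, k + e))

/-- The supermap that reads off the shifts `c` and `e` and applies the map with Choi
operator `K c e`. -/
noncomputable def simulator (K : Fin n → Fin n → Op ((A₀ × B₀) × (A₁ × B₁))) :
    SuperMap (Fin n × Fin n) (Fin n × Fin n) (A₀ × B₀) (A₁ × B₁) where
  toFun F := ofChoi (∑ c, ∑ e, shiftWeight c e F • K c e)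
  map_add' F G := by
    apply choi_injective
    simp [shiftWeight, choi_add, Finset.sum_add_distrib, mul_add, add_smul]
  map_smul' t F := by
    apply choi_injective
    simp [shiftWeight, choi_smul, Finset.smul_sum, ← Finset.mul_sum, smul_smul, mul_left_comm]

variable {K : Fin n → Fin n → Op ((A₀ × B₀) × (A₁ × B₁))}

theorem choi_simulator (F : LMap (Fin n × Fin n) (Fin n × Fin n)) :
    choi (simulator K F) = ∑ c, ∑ e, shiftWeight c e F • K c e :=
  choi_ofChoi _

theorem shiftWeight_noiseless (c e : Fin n) :
    shiftWeight c e (noiseless n) = if c = 0 ∧ e = 0 then 1 else 0 := by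
  have hn : (n : ℂ) ≠ 0 := Nat.cast_ne_zero.2 (NeZero.ne n)
  have h : ∀ k l : Fin n, choi (shift (0 : Fin n) 0) ((k, l), (l + c, k + e))
      ((k, l), (l + c, k + e)) = if c = 0 ∧ e = 0 then 1 else 0 := by
    intro k l
    simp [choi, shift_apply, Matrix.single_apply, and_comm]
  simp only [shiftWeight, noiseless_eq_shift, h]
  split_ifs
  · simp
    field_simp
  · simp

theorem simulator_noiseless : choi (simulator K (noiseless n)) = K 0 0 := by
  rw [choi_simulator, Finset.sum_eq_single 0, Finset.sum_eq_single 0]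
  · simp [shiftWeight_noiseless]
  · intro e _ he
    simp [shiftWeight_noiseless, he]
  · simp
  · intro c _ hc
    exact Finset.sum_eq_zero fun e _ => by simp [shiftWeight_noiseless, hc]
  · simp

/-- For fixed `l`, the output `l + c` runs through all of Alice's outputs as `c` varies, so ignoring
her shift traces out her output. -/
theorem sum_shiftWeight_alice (e : Fin n) (F : LMap (Fin n × Fin n) (Fin n × Fin n)) :
    ∑ c, shiftWeight c e F =
      ((n : ℂ) ^ 2)⁻¹ * ∑ k, ∑ l, margA₀B₀B₁ (choi F) ((k, l), k + e) ((k, l), k + e) := by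
  simp only [shiftWeight, ← Finset.mul_sum]
  congr 1
  rw [Finset.sum_comm]
  refine Finset.sum_congr rfl fun k _ => ?_
  rw [Finset.sum_comm]
  exact Finset.sum_congr rfl fun l _ => Equiv.sum_comp (Equiv.addLeft l)
    fun x => choi F ((k, l), (x, k + e)) ((k, l), (x, k + e))

theorem sum_shiftWeight_bob (c : Fin n) (F : LMap (Fin n × Fin n) (Fin n × Fin n)) :
    ∑ e, shiftWeight c e F =
      ((n : ℂ) ^ 2)⁻¹ * ∑ k, ∑ l, margA₀A₁B₀ (choi F) ((k, l), l + c) ((k, l), l + c) := by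
  simp only [shiftWeight, ← Finset.mul_sum]
  congr 1
  rw [Finset.sum_comm]
  refine Finset.sum_congr rfl fun k _ => ?_
  rw [Finset.sum_comm]
  exact Finset.sum_congr rfl fun l _ => Equiv.sum_comp (Equiv.addLeft k)
    fun y => choi F ((k, l), (l + c, y)) ((k, l), (l + c, y))

theorem margA₀B₀B₁_choi_replaceFst_comp [Nonempty A₁] (Φ : LMap (A₀ × B₀) (A₁ × B₁)) :
    margA₀B₀B₁ (choi (replaceFst A₁ B₁ ∘ₗ Φ)) = margA₀B₀B₁ (choi Φ) := by
  ext ⟨p, y⟩ ⟨q, y'⟩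
  change ∑ x, choi (replaceFst A₁ B₁ ∘ₗ Φ) (p, (x, y)) (q, (x, y')) = _
  simp only [choi_replaceFst_comp]
  simp [maxMixed]

theorem margA₀A₁B₀_choi_replaceSnd_comp [Nonempty B₁] (Φ : LMap (A₀ × B₀) (A₁ × B₁)) :
    margA₀A₁B₀ (choi (replaceSnd A₁ B₁ ∘ₗ Φ)) = margA₀A₁B₀ (choi Φ) := by
  ext ⟨p, x⟩ ⟨q, x'⟩
  change ∑ y, choi (replaceSnd A₁ B₁ ∘ₗ Φ) (p, (x, y)) (q, (x', y)) = _
  simp only [choi_replaceSnd_comp, ← Finset.mul_sum]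
  simp [maxMixed]

/-- Once Alice's input is replaced, Bob's output is independent of `k`; averaging over a uniform `k`
makes `k + e` uniform for every `e`. -/
theorem sum_shiftWeight_comp_replaceFst (e : Fin n)
    (F : LMap (Fin n × Fin n) (Fin n × Fin n)) :
    ∑ c, shiftWeight c e (F ∘ₗ replaceFst (Fin n) (Fin n)) =
      ∑ c, shiftWeight c 0 (F ∘ₗ replaceFst (Fin n) (Fin n)) := by
  rw [sum_shiftWeight_alice, sum_shiftWeight_alice, margA₀B₀B₁_choi_comp_replaceFst]
  have h : ∀ k l y : Fin n, mixA₀ (margA₀B₀B₁ (choi F)) ((k, l), y) ((k, l), y) =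
      (n : ℂ)⁻¹ * ∑ w, margA₀B₀B₁ (choi F) ((w, l), y) ((w, l), y) := by
    intro k l y
    simp [mixA₀, maxMixed]
  simp only [h]
  congr 1
  refine (Equiv.sum_comp (Equiv.addRight e) fun y => ∑ l, (n : ℂ)⁻¹ *
    ∑ w, margA₀B₀B₁ (choi F) ((w, l), y) ((w, l), y)).trans ?_
  simp only [add_zero]

theorem sum_shiftWeight_comp_replaceSnd (c : Fin n)
    (F : LMap (Fin n × Fin n) (Fin n × Fin n)) :
    ∑ e, shiftWeight c e (F ∘ₗ replaceSnd (Fin n) (Fin n)) =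
      ∑ e, shiftWeight 0 e (F ∘ₗ replaceSnd (Fin n) (Fin n)) := by
  rw [sum_shiftWeight_bob, sum_shiftWeight_bob, margA₀A₁B₀_choi_comp_replaceSnd]
  have h : ∀ k l x : Fin n, mixB₀ (margA₀A₁B₀ (choi F)) ((k, l), x) ((k, l), x) =
      (n : ℂ)⁻¹ * ∑ z, margA₀A₁B₀ (choi F) ((k, z), x) ((k, z), x) := by
    intro k l x
    simp [mixB₀, maxMixed]
  simp only [h]
  congr 1
  refine Finset.sum_congr rfl fun k _ => ?_
  refine (Equiv.sum_comp (Equiv.addRight c) fun x => (n : ℂ)⁻¹ *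
    ∑ z, margA₀A₁B₀ (choi F) ((k, z), x) ((k, z), x)).trans ?_
  simp only [add_zero]

theorem isSuperchannel_simulator (hK : ∀ c e, (K c e).PosSemidef)
    (hKt : ∀ c e i j, ∑ x, K c e (i, x) (j, x) = (1 : Op (A₀ × B₀)) i j) :
    IsSuperchannel (simulator K) := by
  intro r₀ r₁ N hN
  have hn : (n : ℂ) ≠ 0 := Nat.cast_ne_zero.2 (NeZero.ne n)
  have hc : ∀ i j p q s s' t t',
      choi (idTensorSuper (simulator K) N) ((i, s), (p, t)) ((j, s'), (q, t')) =
      ((n : ℂ) ^ 2)⁻¹ * ∑ c, ∑ e, ∑ k, ∑ l,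
        choi N ((i, (k, l)), (p, (l + c, k + e))) ((j, (k, l)), (q, (l + c, k + e))) *
          K c e (s, t) (s', t') := by
    intro i j p q s s' t t'
    rw [choi_idTensorSuper, choi_simulator]
    simp only [Matrix.sum_apply, Matrix.smul_apply, shiftWeight, choi_slice, smul_eq_mul,
      Finset.mul_sum, Finset.sum_mul, mul_assoc]
  rw [isChannel_iff]
  constructor
  · have h0 : (0 : ℂ) ≤ ((n : ℂ) ^ 2)⁻¹ := by
      simp
    -- The Choi operator is a positive combination of compressions of `choi N ⊗ K c e`.
    convert Matrix.PosSemidef.smul (Matrix.posSemidef_sum Finset.univ fun c (_ : c ∈ Finset.univ) =>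
      Matrix.posSemidef_sum Finset.univ fun e (_ : e ∈ Finset.univ) =>
      Matrix.posSemidef_sum Finset.univ fun k (_ : k ∈ Finset.univ) =>
      Matrix.posSemidef_sum Finset.univ fun l (_ : l ∈ Finset.univ) =>
      (posSemidef_kronecker hN.posSemidef (hK c e)).submatrix
        fun x : (Fin r₀ × A₀ × B₀) × (Fin r₁ × A₁ × B₁) =>
          (((x.1.1, (k, l)), (x.2.1, (l + c, k + e))), (x.1.2, x.2.2))) h0 using 1
    ext ⟨⟨i, s⟩, p, t⟩ ⟨⟨j, s'⟩, q, t'⟩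
    simp [hc, Matrix.sum_apply]
  · rintro ⟨i, s⟩ ⟨j, s'⟩
    -- For fixed messages the pair `(l + c, k + e)` meets every output exactly once, so trace
    -- preservation of `N` applies.
    have h1 : ∀ k l : Fin n, ∑ p, ∑ c, ∑ e,
        choi N ((i, (k, l)), (p, (l + c, k + e))) ((j, (k, l)), (p, (l + c, k + e))) =
          (1 : Op (Fin r₀)) i j := by
      intro k l
      have h2 := hN.sum_choi (i, (k, l)) (j, (k, l))
      rw [Fintype.sum_prod_type] at h2
      refine Eq.trans (Finset.sum_congr rfl fun p _ => ?_) (h2.trans ?_)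
      · rw [Fintype.sum_prod_type]
        refine Eq.trans ?_ (Equiv.sum_comp (Equiv.addLeft l) fun x => ∑ y,
          choi N ((i, (k, l)), (p, (x, y))) ((j, (k, l)), (p, (x, y))))
        exact Finset.sum_congr rfl fun c _ => Equiv.sum_comp (Equiv.addLeft k) fun y =>
          choi N ((i, (k, l)), (p, (l + c, y))) ((j, (k, l)), (p, (l + c, y)))
      · simp [Matrix.one_apply]
    calc ∑ x : Fin r₁ × (A₁ × B₁),
          choi (idTensorSuper (simulator K) N) ((i, s), x) ((j, s'), x)
        = ((n : ℂ) ^ 2)⁻¹ * ∑ k, ∑ l, (∑ p, ∑ c, ∑ e,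
          choi N ((i, (k, l)), (p, (l + c, k + e))) ((j, (k, l)), (p, (l + c, k + e))))
            * (1 : Op (A₀ × B₀)) s s' := by
          rw [Fintype.sum_prod_type]
          simp only [hc, ← Finset.mul_sum]
          congr 1
          simp only [Finset.sum_mul]
          have h3 : ∀ p c e, ∑ t, ∑ k, ∑ l,
              choi N ((i, (k, l)), (p, (l + c, k + e))) ((j, (k, l)), (p, (l + c, k + e))) *
                K c e (s, t) (s', t) = ∑ k, ∑ l,
              choi N ((i, (k, l)), (p, (l + c, k + e))) ((j, (k, l)), (p, (l + c, k + e))) *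
                (1 : Op (A₀ × B₀)) s s' := by
            intro p c e
            rw [Finset.sum_comm]
            refine Finset.sum_congr rfl fun k _ => ?_
            rw [Finset.sum_comm]
            refine Finset.sum_congr rfl fun l _ => ?_
            rw [← Finset.mul_sum, hKt]
          have h4 : ∀ p, ∑ t, ∑ c, ∑ e, ∑ k, ∑ l,
              choi N ((i, (k, l)), (p, (l + c, k + e))) ((j, (k, l)), (p, (l + c, k + e))) *
                K c e (s, t) (s', t) = ∑ k, ∑ l, ∑ c, ∑ e,
              choi N ((i, (k, l)), (p, (l + c, k + e))) ((j, (k, l)), (p, (l + c, k + e))) *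
                (1 : Op (A₀ × B₀)) s s' := by
            intro p
            rw [Finset.sum_comm]
            have : ∀ c, ∑ t, ∑ e, ∑ k, ∑ l,
              choi N ((i, (k, l)), (p, (l + c, k + e))) ((j, (k, l)), (p, (l + c, k + e))) *
                K c e (s, t) (s', t) = ∑ k, ∑ l, ∑ e,
              choi N ((i, (k, l)), (p, (l + c, k + e))) ((j, (k, l)), (p, (l + c, k + e))) *
                (1 : Op (A₀ × B₀)) s s' := by
              intro c
              rw [Finset.sum_comm, Finset.sum_congr rfl fun e _ => h3 p c e, Finset.sum_comm]
              exact Finset.sum_congr rfl fun k _ => Finset.sum_comm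
            rw [Finset.sum_congr rfl fun c _ => this c, Finset.sum_comm]
            exact Finset.sum_congr rfl fun k _ => Finset.sum_comm
          rw [Finset.sum_congr rfl fun p _ => h4 p, Finset.sum_comm]
          exact Finset.sum_congr rfl fun k _ => Finset.sum_comm
      _ = (1 : Op (Fin r₀ × A₀ × B₀)) (i, s) (j, s') := by
          simp only [h1]
          have h5 : (1 : Op (Fin r₀ × A₀ × B₀)) (i, s) (j, s') =
              (1 : Op (Fin r₀)) i j * (1 : Op (A₀ × B₀)) s s' := by
            simp only [Matrix.one_apply, Prod.mk.injEq]
            by_cases hij : i = j <;> by_cases hs : s = s' <;> simp [hij, hs]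
          rw [h5]
          simp
          field_simp

/-- By `hA`, the A₀B₀B₁ marginal of the image depends only on the distribution of Bob's shift. That
distribution ignores a replacement of Alice's output, and it becomes uniform when her input is
replaced, leaving a multiple of the marginal of `∑ e, K 0 e`, which `hnsA` controls. Bob's
conditions are symmetric. -/
theorem isNSSuperchannel_simulator [Nonempty A₁] [Nonempty B₁] (hK : ∀ c e, (K c e).PosSemidef)
    (hKt : ∀ c e i j, ∑ x, K c e (i, x) (j, x) = (1 : Op (A₀ × B₀)) i j)
    (hA : ∀ c e, margA₀B₀B₁ (K c e) = margA₀B₀B₁ (K 0 e))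
    (hB : ∀ c e, margA₀A₁B₀ (K c e) = margA₀A₁B₀ (K c 0))
    (hnsA : IsNonsignallingA (∑ e, K 0 e)) (hnsB : IsNonsignallingB (∑ c, K c 0)) :
    IsNSSuperchannel (simulator K) := by
  have hmA : ∀ F, margA₀B₀B₁ (choi (simulator K F)) =
      ∑ e, (∑ c, shiftWeight c e F) • margA₀B₀B₁ (K 0 e) := by
    intro F
    simp only [choi_simulator, margA₀B₀B₁_sum, margA₀B₀B₁_smul, Finset.sum_smul]
    rw [Finset.sum_comm]
    exact Finset.sum_congr rfl fun e _ => Finset.sum_congr rfl fun c _ => by rw [hA]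
  have hmB : ∀ F, margA₀A₁B₀ (choi (simulator K F)) =
      ∑ c, (∑ e, shiftWeight c e F) • margA₀A₁B₀ (K c 0) := by
    intro F
    simp only [choi_simulator, margA₀A₁B₀_sum, margA₀A₁B₀_smul, Finset.sum_smul]
    exact Finset.sum_congr rfl fun c _ => Finset.sum_congr rfl fun e _ => by rw [hB]
  refine ⟨isSuperchannel_simulator hK hKt, fun F => ?_, fun F => ?_, fun F => ?_, fun F => ?_⟩
  · rw [replaceFst_comp_replaceFst_eq_iff, isNonsignallingA_iff, hmA]
    simp only [sum_shiftWeight_comp_replaceFst _ F]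
    rw [← Finset.smul_sum, ← margA₀B₀B₁_sum]
    have h : ∀ (t : ℂ) (Z : Op ((A₀ × B₀) × B₁)), mixA₀ (t • Z) = t • mixA₀ Z := by
      intro t Z
      ext p q
      simp [mixA₀, Finset.mul_sum, mul_left_comm]
    rw [h, ← isNonsignallingA_iff.1 hnsA]
  · rw [replaceFst_comp_eq_iff, hmA, hmA]
    simp only [sum_shiftWeight_alice, margA₀B₀B₁_choi_replaceFst_comp]
  · rw [replaceSnd_comp_replaceSnd_eq_iff, isNonsignallingB_iff, hmB]
    simp only [sum_shiftWeight_comp_replaceSnd _ F]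
    rw [← Finset.smul_sum, ← margA₀A₁B₀_sum]
    have h : ∀ (t : ℂ) (Z : Op ((A₀ × B₀) × A₁)), mixB₀ (t • Z) = t • mixB₀ Z := by
      intro t Z
      ext p q
      simp [mixB₀, Finset.mul_sum, mul_left_comm]
    rw [h, ← isNonsignallingB_iff.1 hnsB]
  · rw [replaceSnd_comp_eq_iff, hmB, hmB]
    simp only [sum_shiftWeight_bob, margA₀A₁B₀_choi_replaceSnd_comp]

end Simulator

/-! ### Feasible points of the program -/

section PartialTrace

variable {a b : Type*} [Fintype a] [Fintype b] [DecidableEq a] [DecidableEq b]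

/-- The all-ones matrix is `d` times a projection, so the difference is `d` times the complementary
projection. -/
theorem posSemidef_card_smul_one_sub_ones :
    (((Fintype.card b : ℂ) • (1 : Op b)) - Matrix.of fun _ _ => 1).PosSemidef := by
  rcases isEmpty_or_nonempty b with hb | hb
  · convert Matrix.PosSemidef.zero using 1
    exact Subsingleton.elim _ _
  set d : ℂ := (Fintype.card b : ℂ) with hd
  have hd0 : d ≠ 0 := by simp [hd]
  set E : Op b := Matrix.of fun _ _ => 1 with hE
  have hEE : E * E = d • E := by
    ext i j
    simp [hE, Matrix.mul_apply, hd]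
  have hEh : E.conjTranspose = E := by
    ext i j
    simp [hE]
  have h : (d • (1 : Op b) - E) =
      d⁻¹ • ((d • (1 : Op b) - E).conjTranspose * (d • (1 : Op b) - E)) := by
    have hs : star d = d := by simp [hd]
    rw [Matrix.conjTranspose_sub, Matrix.conjTranspose_smul, Matrix.conjTranspose_one, hEh, hs,
      Matrix.sub_mul, Matrix.mul_sub, Matrix.mul_sub, hEE]
    simp only [Matrix.smul_mul, Matrix.mul_smul, Matrix.one_mul, Matrix.mul_one, sub_self, sub_zero]
    rw [← smul_sub, inv_smul_smul₀ hd0]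
  rw [h]
  refine Matrix.PosSemidef.smul (Matrix.posSemidef_conjTranspose_mul_self _) ?_
  rw [hd]
  simp

/-- An operator is at most `d_b` times its marginal on `a` tensored with the identity. -/
theorem posSemidef_card_smul_marginal_sub {M : Op (a × b)} (hM : M.PosSemidef) :
    ((Fintype.card b : ℂ) • ((Matrix.of fun x x' => ∑ y, M (x, y) (x', y) : Op a) ⊗ₖ (1 : Op b))
      - M).PosSemidef := by
  -- This Schur product is `d` times the block diagonal of `M`, minus `M`.
  have h1 : (M.hadamard (((Fintype.card b : ℂ) • (1 : Op b) - Matrix.of fun _ _ => 1).submatrix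
      Prod.snd Prod.snd)).PosSemidef :=
    hM.hadamard (posSemidef_card_smul_one_sub_ones.submatrix _)
  -- The remainder: in diagonal block `y`, `d` times the sum of all the other diagonal blocks of
  -- `M`.
  have h2 : ((Fintype.card b : ℂ) • ∑ y : b, ∑ z ∈ Finset.univ.erase y,
      (M.submatrix (fun x => (x, z)) (fun x => (x, z))) ⊗ₖ
        Matrix.diagonal (Pi.single y (1 : ℂ))).PosSemidef := by
    refine Matrix.PosSemidef.smul (Matrix.posSemidef_sum _ fun y _ =>
      Matrix.posSemidef_sum _ fun z _ => posSemidef_kronecker (hM.submatrix _) ?_) (by simp)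
    rw [Matrix.posSemidef_diagonal_iff]
    intro i
    by_cases h : i = y
    · subst h
      simp
    · simp [h]
  convert h1.add h2 using 1
  ext ⟨x, y⟩ ⟨x', y'⟩
  by_cases hy : y = y'
  · subst hy
    simp only [Matrix.sub_apply, Matrix.add_apply, Matrix.smul_apply, Matrix.kroneckerMap_apply,
      Matrix.of_apply, Matrix.one_apply_eq, Matrix.hadamard_apply, Matrix.submatrix_apply,
      Matrix.sum_apply, Matrix.diagonal_apply_eq, smul_eq_mul, mul_one]
    have h3 : ∑ w, ∑ z ∈ Finset.univ.erase w,
        M (x, z) (x', z) * (Pi.single w (1 : ℂ) : b → ℂ) y =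
          ∑ z ∈ Finset.univ.erase y, M (x, z) (x', z) := by
      rw [Finset.sum_eq_single y]
      · simp
      · intro w _ hw
        simp [Pi.single_eq_of_ne hw.symm]
      · simp
    rw [h3, ← Finset.add_sum_erase _ _ (Finset.mem_univ y)]
    ring
  · simp [Matrix.sum_apply, hy]

end PartialTrace

/-! ### Monotonicity and feasibility of the program; sufficiency -/

section Program

variable {A₀ B₀ A₁ B₁ : Type*} [Fintype A₀] [Fintype B₀] [Fintype A₁] [Fintype B₁]

theorem sum_margA₀B₀B₁ (X : Op ((A₀ × B₀) × (A₁ × B₁))) (i j : A₀ × B₀) :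
    ∑ y, margA₀B₀B₁ X (i, y) (j, y) = ∑ o, X (i, o) (j, o) := by
  rw [Fintype.sum_prod_type, Finset.sum_comm]
  rfl

theorem sum_margA₀A₁B₀ (X : Op ((A₀ × B₀) × (A₁ × B₁))) (i j : A₀ × B₀) :
    ∑ x, margA₀A₁B₀ X (i, x) (j, x) = ∑ o, X (i, o) (j, o) := by
  rw [Fintype.sum_prod_type]
  rfl

theorem trace_eq_sum_sum (X : Op ((A₀ × B₀) × (A₁ × B₁))) :
    X.trace = ∑ i, ∑ o, X (i, o) (i, o) :=
  Fintype.sum_prod_type _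

variable [DecidableEq A₀] [DecidableEq B₀] [DecidableEq A₁] [DecidableEq B₁]
variable {N : LMap (A₀ × B₀) (A₁ × B₁)} {m : ℝ} {V W X : Op ((A₀ × B₀) × (A₁ × B₁))}

theorem SDPFeasible.sum_V (h : SDPFeasible (choi N) m V W X) (hN : IsChannel N) (i j : A₀ × B₀) :
    ∑ o, V (i, o) (j, o) = m * (1 : Op (A₀ × B₀)) i j := by
  rw [← sum_margA₀A₁B₀, ← h.V_A₀A₁B₀]
  simp only [Matrix.smul_apply, smul_eq_mul, ← Finset.mul_sum, sum_margA₀A₁B₀, hN.sum_choi]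

theorem SDPFeasible.sum_W (h : SDPFeasible (choi N) m V W X) (hN : IsChannel N) (i j : A₀ × B₀) :
    ∑ o, W (i, o) (j, o) = m * (1 : Op (A₀ × B₀)) i j := by
  rw [← sum_margA₀B₀B₁, ← h.W_A₀B₀B₁]
  simp only [Matrix.smul_apply, smul_eq_mul, ← Finset.mul_sum, sum_margA₀B₀B₁, hN.sum_choi]

theorem SDPFeasible.sum_X (h : SDPFeasible (choi N) m V W X) (hN : IsChannel N) (i j : A₀ × B₀) :
    ∑ o, X (i, o) (j, o) = m * (1 : Op (A₀ × B₀)) i j := by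
  rw [← h.sum_V hN, ← sum_margA₀B₀B₁, h.X_V_A₀B₀B₁, sum_margA₀B₀B₁]

theorem SDPFeasible.one_le [Nonempty A₀] [Nonempty B₀] (h : SDPFeasible (choi N) m V W X)
    (hN : IsChannel N) : 1 ≤ m := by
  obtain ⟨i⟩ := (inferInstance : Nonempty (A₀ × B₀))
  have h1 : (0 : ℂ) ≤ ∑ o, (V - choi N) (i, o) (i, o) :=
    Finset.sum_nonneg fun o _ => h.V_ge.diag_nonneg
  simp only [Matrix.sub_apply, Finset.sum_sub_distrib, h.sum_V hN, hN.sum_choi,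
    Matrix.one_apply_eq, mul_one] at h1
  have h2 : (1 : ℂ) ≤ m := sub_nonneg.1 h1
  exact_mod_cast h2

/-- The positive differences have trace zero. This covers `n = 1`, where no nonzero shift is
available to carry `V - J` or `W - J`. -/
theorem SDPFeasible.eq_of_one (h : SDPFeasible (choi N) 1 V W X) (hN : IsChannel N) :
    V = choi N ∧ W = choi N := by
  constructor
  · rw [← sub_eq_zero, ← h.V_ge.trace_eq_zero_iff]
    simp only [trace_eq_sum_sum, Matrix.sub_apply, Finset.sum_sub_distrib, h.sum_V hN, hN.sum_choi]
    simp
  · rw [← sub_eq_zero, ← h.W_ge.trace_eq_zero_iff]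
    simp only [trace_eq_sum_sum, Matrix.sub_apply, Finset.sum_sub_distrib, h.sum_W hN, hN.sum_choi]
    simp

/-- The Choi operator of the map followed by the replacement of Bob's output. -/
noncomputable def replaceB₁ (J : Op ((A₀ × B₀) × (A₁ × B₁))) : Op ((A₀ × B₀) × (A₁ × B₁)) :=
  (margA₀A₁B₀ J ⊗ₖ maxMixed B₁).submatrix (fun p => ((p.1, p.2.1), p.2.2))
    (fun p => ((p.1, p.2.1), p.2.2))

/-- The Choi operator of the map followed by the replacement of Alice's output. -/
noncomputable def replaceA₁ (J : Op ((A₀ × B₀) × (A₁ × B₁))) : Op ((A₀ × B₀) × (A₁ × B₁)) :=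
  (margA₀B₀B₁ J ⊗ₖ maxMixed A₁).submatrix (fun p => ((p.1, p.2.2), p.2.1))
    (fun p => ((p.1, p.2.2), p.2.1))

/-- The Choi operator of the completely depolarizing channel. -/
noncomputable def depolarizing : Op ((A₀ × B₀) × (A₁ × B₁)) :=
  1 ⊗ₖ (maxMixed A₁ ⊗ₖ maxMixed B₁)

theorem posSemidef_maxMixed (a : Type*) [Fintype a] [DecidableEq a] :
    (maxMixed a).PosSemidef :=
  Matrix.PosSemidef.one.smul (by simp)

theorem sum_maxMixed (a : Type*) [Fintype a] [DecidableEq a] [Nonempty a] :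
    ∑ x, maxMixed a x x = 1 := by
  simp [maxMixed]

theorem posSemidef_replaceB₁ {J : Op ((A₀ × B₀) × (A₁ × B₁))} (hJ : J.PosSemidef) :
    (replaceB₁ J).PosSemidef :=
  (posSemidef_kronecker (posSemidef_margA₀A₁B₀ hJ) (posSemidef_maxMixed B₁)).submatrix _

theorem posSemidef_replaceA₁ {J : Op ((A₀ × B₀) × (A₁ × B₁))} (hJ : J.PosSemidef) :
    (replaceA₁ J).PosSemidef :=
  (posSemidef_kronecker (posSemidef_margA₀B₀B₁ hJ) (posSemidef_maxMixed A₁)).submatrix _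

theorem posSemidef_depolarizing :
    (depolarizing : Op ((A₀ × B₀) × (A₁ × B₁))).PosSemidef :=
  posSemidef_kronecker .one (posSemidef_kronecker (posSemidef_maxMixed A₁) (posSemidef_maxMixed B₁))

theorem margA₀A₁B₀_replaceB₁ [Nonempty B₁] (J : Op ((A₀ × B₀) × (A₁ × B₁))) :
    margA₀A₁B₀ (replaceB₁ J) = margA₀A₁B₀ J := by
  ext p q
  simp [margA₀A₁B₀, replaceB₁, ← Finset.mul_sum, sum_maxMixed]

theorem margA₀B₀B₁_replaceA₁ [Nonempty A₁] (J : Op ((A₀ × B₀) × (A₁ × B₁))) :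
    margA₀B₀B₁ (replaceA₁ J) = margA₀B₀B₁ J := by
  ext p q
  simp [margA₀B₀B₁, replaceA₁, ← Finset.mul_sum, sum_maxMixed]

theorem margA₀B₀B₁_depolarizing [Nonempty A₁] :
    margA₀B₀B₁ (depolarizing : Op ((A₀ × B₀) × (A₁ × B₁))) = 1 ⊗ₖ maxMixed B₁ := by
  ext p q
  change ∑ x, (1 : Op (A₀ × B₀)) p.1 q.1 * (maxMixed A₁ x x * maxMixed B₁ p.2 q.2) =
    (1 : Op (A₀ × B₀)) p.1 q.1 * maxMixed B₁ p.2 q.2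
  rw [← Finset.mul_sum, ← Finset.sum_mul, sum_maxMixed, one_mul]

theorem margA₀A₁B₀_depolarizing [Nonempty B₁] :
    margA₀A₁B₀ (depolarizing : Op ((A₀ × B₀) × (A₁ × B₁))) = 1 ⊗ₖ maxMixed A₁ := by
  ext p q
  change ∑ y, (1 : Op (A₀ × B₀)) p.1 q.1 * (maxMixed A₁ p.2 q.2 * maxMixed B₁ y y) =
    (1 : Op (A₀ × B₀)) p.1 q.1 * maxMixed A₁ p.2 q.2
  rw [← Finset.mul_sum, ← Finset.mul_sum, sum_maxMixed, mul_one]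

theorem IsChannel.margA₀B₀B₁_replaceB₁ (hN : IsChannel N) :
    margA₀B₀B₁ (replaceB₁ (choi N)) = 1 ⊗ₖ maxMixed B₁ := by
  ext ⟨p, y⟩ ⟨q, y'⟩
  change ∑ x, margA₀A₁B₀ (choi N) (p, x) (q, x) * maxMixed B₁ y y' = _
  rw [← Finset.sum_mul, sum_margA₀A₁B₀, hN.sum_choi]
  rfl

theorem IsChannel.margA₀A₁B₀_replaceA₁ (hN : IsChannel N) :
    margA₀A₁B₀ (replaceA₁ (choi N)) = 1 ⊗ₖ maxMixed A₁ := by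
  ext ⟨p, x⟩ ⟨q, x'⟩
  change ∑ y, margA₀B₀B₁ (choi N) (p, y) (q, y) * maxMixed A₁ x x' = _
  rw [← Finset.sum_mul, sum_margA₀B₀B₁, hN.sum_choi]
  rfl

theorem isNonsignallingA_depolarizing [Nonempty A₀] [Nonempty A₁] :
    IsNonsignallingA (depolarizing : Op ((A₀ × B₀) × (A₁ × B₁))) := by
  rw [isNonsignallingA_iff, margA₀B₀B₁_depolarizing]
  ext ⟨⟨w, b⟩, y⟩ ⟨⟨w', b'⟩, y'⟩
  by_cases hw : w = w' <;> by_cases hb : b = b' <;> simp [mixA₀, maxMixed, Matrix.one_apply, hw, hb]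

theorem isNonsignallingB_depolarizing [Nonempty B₀] [Nonempty B₁] :
    IsNonsignallingB (depolarizing : Op ((A₀ × B₀) × (A₁ × B₁))) := by
  rw [isNonsignallingB_iff, margA₀A₁B₀_depolarizing]
  ext ⟨⟨w, b⟩, y⟩ ⟨⟨w', b'⟩, y'⟩
  by_cases hw : w = w' <;> by_cases hb : b = b' <;> simp [mixB₀, maxMixed, Matrix.one_apply, hw, hb]

theorem IsNonsignallingA.add_smul {X Y : Op ((A₀ × B₀) × (A₁ × B₁))} (hX : IsNonsignallingA X)
    (hY : IsNonsignallingA Y) (t : ℂ) : IsNonsignallingA (X + t • Y) := by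
  rw [isNonsignallingA_iff] at *
  rw [margA₀B₀B₁_add, margA₀B₀B₁_smul]
  conv_lhs => rw [hX, hY]
  ext p q
  simp only [mixA₀, Matrix.add_apply, Matrix.smul_apply, Matrix.of_apply, smul_eq_mul,
    Finset.sum_add_distrib, ← Finset.mul_sum]
  ring

theorem IsNonsignallingB.add_smul {X Y : Op ((A₀ × B₀) × (A₁ × B₁))} (hX : IsNonsignallingB X)
    (hY : IsNonsignallingB Y) (t : ℂ) : IsNonsignallingB (X + t • Y) := by
  rw [isNonsignallingB_iff] at *
  rw [margA₀A₁B₀_add, margA₀A₁B₀_smul]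
  conv_lhs => rw [hX, hY]
  ext p q
  simp only [mixB₀, Matrix.add_apply, Matrix.smul_apply, Matrix.of_apply, smul_eq_mul,
    Finset.sum_add_distrib, ← Finset.mul_sum]
  ring

variable [Nonempty A₀] [Nonempty B₀] [Nonempty A₁] [Nonempty B₁]

/-- Feasibility is monotone in the objective. -/
theorem SDPFeasible.mono (h : SDPFeasible (choi N) m V W X) (hN : IsChannel N) {m' : ℝ}
    (hm : m ≤ m') : SDPFeasible (choi N) m' (V + ((m' - m : ℝ) : ℂ) • replaceB₁ (choi N))
      (W + ((m' - m : ℝ) : ℂ) • replaceA₁ (choi N)) (X + ((m' - m : ℝ) : ℂ) • depolarizing) := by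
  -- The added noise has the right marginals: `replaceB₁` keeps the A₀A₁B₀ marginal of `J` and
  -- `replaceA₁` the A₀B₀B₁ one, while their other marginals agree with those of `depolarizing`.
  have ht : (0 : ℂ) ≤ ((m' - m : ℝ) : ℂ) := Complex.zero_le_real.2 (sub_nonneg.2 hm)
  have hm' : ((m' - m : ℝ) : ℂ) = (m' : ℂ) - m := by push_cast; rfl
  refine ⟨?_, ?_, ?_, IsNonsignallingA.add_smul h.X_nsA isNonsignallingA_depolarizing _,
    IsNonsignallingB.add_smul h.X_nsB isNonsignallingB_depolarizing _, ?_, ?_, ?_, ?_⟩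
  · rw [add_sub_right_comm]
    exact h.V_ge.add ((posSemidef_replaceB₁ hN.posSemidef).smul ht)
  · rw [add_sub_right_comm]
    exact h.W_ge.add ((posSemidef_replaceA₁ hN.posSemidef).smul ht)
  · rw [add_sub_right_comm]
    exact h.X_ge.add (posSemidef_depolarizing.smul ht)
  · rw [margA₀B₀B₁_add, margA₀B₀B₁_smul, margA₀B₀B₁_replaceA₁, ← h.W_A₀B₀B₁, ← _root_.add_smul, hm',
      add_sub_cancel]
  · rw [margA₀B₀B₁_add, margA₀B₀B₁_smul, margA₀B₀B₁_add, margA₀B₀B₁_smul, hN.margA₀B₀B₁_replaceB₁,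
      margA₀B₀B₁_depolarizing, h.X_V_A₀B₀B₁]
  · rw [margA₀A₁B₀_add, margA₀A₁B₀_smul, margA₀A₁B₀_replaceB₁, ← h.V_A₀A₁B₀, ← _root_.add_smul, hm',
      add_sub_cancel]
  · rw [margA₀A₁B₀_add, margA₀A₁B₀_smul, margA₀A₁B₀_add, margA₀A₁B₀_smul, hN.margA₀A₁B₀_replaceA₁,
      margA₀A₁B₀_depolarizing, h.X_W_A₀A₁B₀]

/-- The program has a feasible point. -/
theorem IsChannel.exists_sdpFeasible (hN : IsChannel N) :
    ∃ (m : ℝ) (V W X : Op ((A₀ × B₀) × (A₁ × B₁))), SDPFeasible (choi N) m V W X := by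
  have hJ := hN.posSemidef
  set dA : ℕ := Fintype.card A₁ with hdA
  set dB : ℕ := Fintype.card B₁ with hdB
  have hA0 : (dA : ℂ) ≠ 0 := by simp [hdA]
  have hB0 : (dB : ℂ) ≠ 0 := by simp [hdB]
  have hA1 : 1 ≤ dA ^ 2 := Nat.one_le_pow _ _ Fintype.card_pos
  have hB1 : 1 ≤ dB ^ 2 := Nat.one_le_pow _ _ Fintype.card_pos
  have hle : ∀ {k l : ℕ}, k ≤ l → (0 : ℂ) ≤ (l : ℂ) - k := fun h => by
    rw [sub_nonneg]; exact_mod_cast h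
  -- `posSemidef_card_smul_marginal_sub` and the normalisation of `π` need factors `dB ^ 2`, `dA ^
  -- 2` and `dA ^ 2 * dB ^ 2` for `V`, `W`, `X`; the largest serves all three.
  set M : ℕ := dA ^ 2 * dB ^ 2 with hM
  refine ⟨M, (M : ℂ) • replaceB₁ (choi N), (M : ℂ) • replaceA₁ (choi N), (M : ℂ) • depolarizing,
    ?_, ?_, ?_, ?_, ?_, ?_, ?_, ?_, ?_⟩
  · have h1 := (posSemidef_card_smul_marginal_sub (hJ.submatrix
      fun p : ((A₀ × B₀) × A₁) × B₁ => (p.1.1, (p.1.2, p.2)))).submatrix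
      fun p : (A₀ × B₀) × (A₁ × B₁) => ((p.1, p.2.1), p.2.2)
    have h2 := (posSemidef_replaceB₁ hJ).smul
      (hle (show dB ^ 2 ≤ M from Nat.le_mul_of_pos_left _ hA1))
    convert h1.add h2 using 1
    ext p q
    simp only [replaceB₁, margA₀A₁B₀, maxMixed, Matrix.sub_apply, Matrix.add_apply,
      Matrix.smul_apply, Matrix.submatrix_apply, Matrix.kroneckerMap_apply, Matrix.of_apply,
      smul_eq_mul, ← hdB]
    push_cast
    field_simp
    ring
  · have h1 := (posSemidef_card_smul_marginal_sub (hJ.submatrix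
      fun p : ((A₀ × B₀) × B₁) × A₁ => (p.1.1, (p.2, p.1.2)))).submatrix
      fun p : (A₀ × B₀) × (A₁ × B₁) => ((p.1, p.2.2), p.2.1)
    have h2 := (posSemidef_replaceA₁ hJ).smul
      (hle (show dA ^ 2 ≤ M from Nat.le_mul_of_pos_right _ hB1))
    convert h1.add h2 using 1
    ext p q
    simp only [replaceA₁, margA₀B₀B₁, maxMixed, Matrix.sub_apply, Matrix.add_apply,
      Matrix.smul_apply, Matrix.submatrix_apply, Matrix.kroneckerMap_apply, Matrix.of_apply,
      smul_eq_mul, ← hdA]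
    push_cast
    field_simp
    ring
  · convert posSemidef_card_smul_marginal_sub hJ using 1
    ext ⟨p, x, y⟩ ⟨q, x', y'⟩
    have h1 : (1 : Op (A₁ × B₁)) (x, y) (x', y') = (1 : Op A₁) x x' * (1 : Op B₁) y y' := by
      simp only [Matrix.one_apply, Prod.mk.injEq]
      by_cases hx : x = x' <;> by_cases hy : y = y' <;> simp [hx, hy]
    simp only [depolarizing, maxMixed, Matrix.sub_apply, Matrix.smul_apply,
      Matrix.kroneckerMap_apply, Matrix.of_apply, smul_eq_mul, hN.sum_choi, h1,
      Fintype.card_prod, ← hdA, ← hdB, hM]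
    push_cast
    field_simp
  · have := IsNonsignallingA.add_smul (X := (0 : Op ((A₀ × B₀) × (A₁ × B₁))))
      (isNonsignallingA_iff.2 ?_) isNonsignallingA_depolarizing (M : ℂ)
    · rwa [zero_add] at this
    · ext p q
      simp [margA₀B₀B₁, mixA₀]
  · have := IsNonsignallingB.add_smul (X := (0 : Op ((A₀ × B₀) × (A₁ × B₁))))
      (isNonsignallingB_iff.2 ?_) isNonsignallingB_depolarizing (M : ℂ)
    · rwa [zero_add] at this
    · ext p q
      simp [margA₀A₁B₀, mixB₀]
  · rw [margA₀B₀B₁_smul, margA₀B₀B₁_replaceA₁]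
    push_cast
    rfl
  · rw [margA₀B₀B₁_smul, margA₀B₀B₁_smul, hN.margA₀B₀B₁_replaceB₁, margA₀B₀B₁_depolarizing]
  · rw [margA₀A₁B₀_smul, margA₀A₁B₀_replaceB₁]
    push_cast
    rfl
  · rw [margA₀A₁B₀_smul, margA₀A₁B₀_smul, hN.margA₀A₁B₀_replaceA₁, margA₀A₁B₀_depolarizing]

/-- The `n - 1` nonzero indices share `V - J` equally. For `n = 1` there are none, hence the
hypothesis. -/
theorem add_sum_erase_inv_smul {n : ℕ} [NeZero n] {E : Type*} [AddCommGroup E] [Module ℂ E]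
    (J V : E) (h : n = 1 → V = J) :
    ∑ e : Fin n, (if e = 0 then J else ((n : ℂ) - 1)⁻¹ • (V - J)) = V := by
  rw [← Finset.add_sum_erase _ _ (Finset.mem_univ 0), if_pos rfl,
    Finset.sum_congr rfl fun e he => if_neg (Finset.ne_of_mem_erase he), Finset.sum_const,
    Finset.card_erase_of_mem (Finset.mem_univ _), Finset.card_univ, Fintype.card_fin]
  by_cases hn : n = 1
  · simp [hn, h hn]
  · have h1 : 1 ≤ n := NeZero.one_le
    have h2 : ((n - 1 : ℕ) : ℂ) = (n : ℂ) - 1 := by push_cast [h1]; rfl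
    have h3 : (n : ℂ) - 1 ≠ 0 := by
      rw [sub_ne_zero]
      exact_mod_cast hn
    rw [← Nat.cast_smul_eq_nsmul ℂ, h2, smul_inv_smul₀ h3, add_sub_cancel]

/-- The element `c ≠ 0` serves only to exclude `n = 1`. -/
theorem inv_sub_one_smul {n : ℕ} [NeZero n] {E : Type*} [AddCommGroup E] [Module ℂ E]
    {c : Fin n} (hc : c ≠ 0) (Z : E) : ((n : ℂ) - 1)⁻¹ • ((n : ℂ) • Z - Z) = Z := by
  have hn : (n : ℂ) - 1 ≠ 0 := by
    intro h1
    have h2 : n = 1 := by exact_mod_cast sub_eq_zero.1 h1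
    subst h2
    exact hc (Subsingleton.elim _ _)
  have : (n : ℂ) • Z - Z = ((n : ℂ) - 1) • Z := by rw [sub_smul, one_smul]
  rw [this, inv_smul_smul₀ hn]

/-- A feasible point at `n` yields an exact simulation by `n` messages. -/
theorem SDPFeasible.exists_isNSSuperchannel {n : ℕ} [NeZero n]
    (h : SDPFeasible (choi N) n V W X) (hN : IsChannel N) :
    ∃ Θ : SuperMap (Fin n × Fin n) (Fin n × Fin n) (A₀ × B₀) (A₁ × B₁),
      IsNSSuperchannel Θ ∧ Θ (noiseless n) = N := by
  set J := choi N with hJ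
  set t : ℂ := ((n : ℂ) - 1)⁻¹ with ht
  have ht0 : 0 ≤ t := by
    have h1 : (1 : ℂ) ≤ n := by exact_mod_cast (NeZero.one_le : 1 ≤ n)
    have h2 : 0 ≤ ((n : ℝ) - 1)⁻¹ := inv_nonneg.2 (sub_nonneg.2 (by exact_mod_cast h1))
    have h3 := Complex.zero_le_real.2 h2
    push_cast at h3
    exact h3
  -- Row zero sums to `V` and column zero to `W`. The constraints linking `X` to `V` and `W` give
  -- the inner entries the required marginals.
  let K : Fin n → Fin n → Op ((A₀ × B₀) × (A₁ × B₁)) := fun c e =>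
    if c = 0 then if e = 0 then J else t • (V - J)
    else if e = 0 then t • (W - J) else t • (X - J)
  have hV : margA₀A₁B₀ V = (n : ℂ) • margA₀A₁B₀ J := by simpa using h.V_A₀A₁B₀.symm
  have hW : margA₀B₀B₁ W = (n : ℂ) • margA₀B₀B₁ J := by simpa using h.W_A₀B₀B₁.symm
  have hone : n = 1 → V = J ∧ W = J := by
    rintro rfl
    rw [Nat.cast_one] at h
    exact h.eq_of_one hN
  have hK0 : (∑ e, K 0 e) = V := by
    simp only [K, if_true]
    exact add_sum_erase_inv_smul J V fun h1 => (hone h1).1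
  have hK1 : (∑ c, K c 0) = W := by
    simp only [K, if_true]
    exact add_sum_erase_inv_smul J W fun h1 => (hone h1).2
  have htp : ∀ (Z : Op ((A₀ × B₀) × (A₁ × B₁))),
      (∀ i j, ∑ o, Z (i, o) (j, o) = ((n : ℝ) : ℂ) * (1 : Op (A₀ × B₀)) i j) →
      ∀ c : Fin n, c ≠ 0 → ∀ i j, ∑ o, (t • (Z - J)) (i, o) (j, o) = (1 : Op (A₀ × B₀)) i j := by
    intro Z hZ c hc i j
    have := inv_sub_one_smul hc ((1 : Op (A₀ × B₀)) i j)
    simp only [Matrix.smul_apply, Matrix.sub_apply, smul_eq_mul, ← Finset.mul_sum,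
      Finset.sum_sub_distrib, hZ, hJ, hN.sum_choi]
    simpa [ht] using this
  refine ⟨simulator K, isNSSuperchannel_simulator ?_ ?_ ?_ ?_ ?_ ?_, ?_⟩
  · intro c e
    simp only [K]
    split_ifs
    exacts [hN.posSemidef, h.V_ge.smul ht0, h.W_ge.smul ht0, h.X_ge.smul ht0]
  · intro c e
    simp only [K]
    split_ifs with hc he he
    exacts [hN.sum_choi, htp V (h.sum_V hN) e he, htp W (h.sum_W hN) c hc, htp X (h.sum_X hN) c hc]
  · intro c e
    simp only [K, if_true]
    split_ifs with hc he he
    · rfl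
    · rfl
    · rw [margA₀B₀B₁_smul, margA₀B₀B₁_sub, hW, ht, inv_sub_one_smul hc]
    · rw [margA₀B₀B₁_smul, margA₀B₀B₁_sub, margA₀B₀B₁_smul, margA₀B₀B₁_sub, h.X_V_A₀B₀B₁]
  · intro c e
    simp only [K, if_true]
    split_ifs with hc he he
    · rfl
    · rw [margA₀A₁B₀_smul, margA₀A₁B₀_sub, hV, ht, inv_sub_one_smul he]
    · rfl
    · rw [margA₀A₁B₀_smul, margA₀A₁B₀_sub, margA₀A₁B₀_smul, margA₀A₁B₀_sub, h.X_W_A₀A₁B₀]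
  · rw [hK0, isNonsignallingA_iff, ← h.X_V_A₀B₀B₁]
    exact isNonsignallingA_iff.1 h.X_nsA
  · rw [hK1, isNonsignallingB_iff, ← h.X_W_A₀A₁B₀]
    exact isNonsignallingB_iff.1 h.X_nsB
  · apply choi_injective
    rw [simulator_noiseless]
    simp [K, hJ]

end Program

/-! ### Norms and compactness -/

section Norms

variable {a b : Type*} [Fintype a] [Fintype b] [DecidableEq a] [DecidableEq b]

theorem sum_eigenvalues_conjTranspose_mul_self (X : Op a) :
    ∑ i, (Matrix.isHermitian_conjTranspose_mul_self X).eigenvalues i = ∑ i, ∑ j, ‖X i j‖ ^ 2 := by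
  have h := (Matrix.isHermitian_conjTranspose_mul_self X).trace_eq_sum_eigenvalues
  have h2 : (X.conjTranspose * X).trace = ((∑ i, ∑ j, ‖X i j‖ ^ 2 : ℝ) : ℂ) := by
    simp only [Matrix.trace, Matrix.diag_apply, Matrix.mul_apply, Matrix.conjTranspose_apply]
    rw [Finset.sum_comm]
    push_cast
    exact Finset.sum_congr rfl fun i _ => Finset.sum_congr rfl fun j _ =>
      Complex.conj_mul' (X i j)
  rw [h2] at h
  have h3 : ((∑ i, ∑ j, ‖X i j‖ ^ 2 : ℝ) : ℂ) =
      ((∑ i, (Matrix.isHermitian_conjTranspose_mul_self X).eigenvalues i : ℝ) : ℂ) := by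
    rw [h]
    push_cast
    rfl
  exact (Complex.ofReal_injective h3).symm

theorem eigenvalues_conjTranspose_mul_self_nonneg (X : Op a) (i : a) :
    0 ≤ (Matrix.isHermitian_conjTranspose_mul_self X).eigenvalues i :=
  (Matrix.posSemidef_conjTranspose_mul_self X).eigenvalues_nonneg i

/-- An entry is at most the Frobenius norm, which is at most the sum of the singular values. -/
theorem norm_apply_le_traceNorm (X : Op a) (i j : a) : ‖X i j‖ ≤ traceNorm X := by
  have h0 : 0 ≤ traceNorm X := Finset.sum_nonneg fun _ _ => Real.sqrt_nonneg _
  refine abs_le_of_sq_le_sq' ?_ h0 |>.2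
  calc ‖X i j‖ ^ 2 ≤ ∑ j, ‖X i j‖ ^ 2 :=
        Finset.single_le_sum (f := fun j => ‖X i j‖ ^ 2) (fun _ _ => sq_nonneg _)
          (Finset.mem_univ j)
    _ ≤ ∑ i, ∑ j, ‖X i j‖ ^ 2 :=
        Finset.single_le_sum (f := fun i => ∑ j, ‖X i j‖ ^ 2)
          (fun _ _ => Finset.sum_nonneg fun _ _ => sq_nonneg _) (Finset.mem_univ i)
    _ = ∑ i, Real.sqrt ((Matrix.isHermitian_conjTranspose_mul_self X).eigenvalues i) ^ 2 := by
        rw [← sum_eigenvalues_conjTranspose_mul_self]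
        exact Finset.sum_congr rfl fun i _ =>
          (Real.sq_sqrt (eigenvalues_conjTranspose_mul_self_nonneg X i)).symm
    _ ≤ traceNorm X ^ 2 := Finset.sum_sq_le_sq_sum_of_nonneg fun _ _ => Real.sqrt_nonneg _

theorem traceNorm_le (X : Op a) :
    traceNorm X ≤ Fintype.card a * Real.sqrt (∑ i, ∑ j, ‖X i j‖ ^ 2) := by
  rw [← nsmul_eq_mul, ← Finset.card_univ, ← Finset.sum_const]
  refine Finset.sum_le_sum fun i _ => Real.sqrt_le_sqrt ?_
  rw [← sum_eigenvalues_conjTranspose_mul_self]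
  exact Finset.single_le_sum (fun i _ => eigenvalues_conjTranspose_mul_self_nonneg X i)
    (Finset.mem_univ i)

theorem traceNorm_zero : traceNorm (0 : Op a) = 0 :=
  le_antisymm ((traceNorm_le 0).trans (by simp)) (Finset.sum_nonneg fun _ _ => Real.sqrt_nonneg _)

theorem diamondNorm_zero : diamondNorm (0 : LMap a b) = 0 := by
  have h : ∀ (k : ℕ) (X : Op (Fin k × a)), idTensor (Fin k) (0 : LMap a b) X = 0 := by
    intro k X
    ext p q
    simp [idTensor]
  simp [diamondNorm, h, traceNorm_zero]

theorem norm_choi_le_of_diamondNorm_lt (F : LMap a b) {δ : ℝ} (hδ : 0 < δ)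
    (h : diamondNorm F < ENNReal.ofReal δ) (p q : a × b) :
    ‖choi F p q‖ ≤ Fintype.card a * δ := by
  have : Nonempty a := ⟨p.1⟩
  have hc : (0 : ℝ) < Fintype.card a := by exact_mod_cast Fintype.card_pos
  -- This scaling brings the crude bound `traceNorm_le` for the probe `X` down to `1`.
  set t : ℝ := (Fintype.card a : ℝ)⁻¹ with ht
  have ht0 : 0 < t := inv_pos.2 hc
  let X : Op (Fin 1 × a) := Matrix.single (0, p.1) (0, q.1) (t : ℂ)
  have hX : traceNorm X ≤ 1 := by
    refine (traceNorm_le X).trans ?_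
    have h1 : ∑ i, ∑ j, ‖X i j‖ ^ 2 = t ^ 2 := by
      rw [Finset.sum_eq_single (0, p.1), Finset.sum_eq_single (0, q.1)]
      · simp [X]
      · intro j _ hj
        simp [X, hj.symm]
      · simp
      · intro i _ hi
        exact Finset.sum_eq_zero fun j _ => by simp [X, hi.symm]
      · simp
    rw [h1, Real.sqrt_sq ht0.le, ht]
    simp
  have h2 : ENNReal.ofReal (traceNorm (idTensor (Fin 1) F X)) ≤ diamondNorm F :=
    le_iSup_of_le 1 (le_iSup_of_le X (le_iSup_of_le hX le_rfl))
  have h3 := (ENNReal.ofReal_lt_ofReal_iff hδ).1 (h2.trans_lt h)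
  have h4 : idTensor (Fin 1) F X (0, p.2) (0, q.2) = (t : ℂ) * choi F p q := by
    have : X.submatrix (Prod.mk 0) (Prod.mk 0) = (t : ℂ) • Matrix.single p.1 q.1 (1 : ℂ) := by
      ext i j
      simp [X, Matrix.single_apply]
    change F (X.submatrix (Prod.mk 0) (Prod.mk 0)) p.2 q.2 = _
    rw [this, map_smul]
    rfl
  have h5 := (norm_apply_le_traceNorm (idTensor (Fin 1) F X) (0, p.2) (0, q.2)).trans h3.le
  rw [h4, norm_mul, Complex.norm_real, Real.norm_of_nonneg ht0.le, ht, inv_mul_le_iff₀ hc] at h5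
  exact h5

/-- The `2 × 2` principal minors give `‖M i j‖ ^ 2 ≤ M i i * M j j`. -/
theorem norm_apply_le_trace {M : Op a} (hM : M.PosSemidef) (i j : a) : ‖M i j‖ ≤ M.trace.re := by
  have hd : ∀ k, 0 ≤ (M k k).re ∧ ((M k k).re : ℂ) = M k k := fun k => by
    have := hM.diag_nonneg (i := k)
    rw [Complex.nonneg_iff] at this
    exact ⟨this.1, Complex.ext (by simp) (by simp [← this.2])⟩
  have hle : ∀ k, (M k k).re ≤ M.trace.re := fun k => by
    rw [Matrix.trace, Complex.re_sum]
    exact Finset.single_le_sum (f := fun k => (M k k).re) (fun k _ => (hd k).1) (Finset.mem_univ k)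
  have h1 := (hM.submatrix ![i, j]).det_nonneg
  rw [Matrix.det_fin_two] at h1
  simp only [Matrix.submatrix_apply, Matrix.cons_val_zero, Matrix.cons_val_one] at h1
  have h2 : M i j * M j i = ((‖M i j‖ ^ 2 : ℝ) : ℂ) := by
    rw [← hM.isHermitian.apply j i]
    push_cast
    exact Complex.mul_conj' _
  rw [h2, ← (hd i).2, ← (hd j).2, ← Complex.ofReal_mul, ← Complex.ofReal_sub,
    Complex.zero_le_real] at h1
  refine abs_le_of_sq_le_sq' ?_ ((hd i).1.trans (hle i)) |>.2
  nlinarith [mul_le_mul (hle i) (hle j) (hd j).1 ((hd i).1.trans (hle i))]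

theorem isClosed_posSemidef : IsClosed {M : Op a | M.PosSemidef} := by
  simp only [Matrix.posSemidef_iff_dotProduct_mulVec, Set.ofPred_and, Set.ofPred_forall]
  refine IsClosed.inter ?_ (isClosed_iInter fun x => ?_)
  · exact isClosed_eq continuous_id.matrix_conjTranspose continuous_id
  · exact isClosed_le continuous_const
      (continuous_const.dotProduct (continuous_id.matrix_mulVec continuous_const))

theorem isCompact_entries_le (C : ℝ) : IsCompact {M : Op a | ∀ i j, ‖M i j‖ ≤ C} := by
  have h : IsCompact (Set.univ.pi fun _ : a => Set.univ.pi fun _ : a =>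
      Metric.closedBall (0 : ℂ) C) :=
    isCompact_univ_pi fun _ => isCompact_univ_pi fun _ => isCompact_closedBall 0 C
  have h2 : {M : Op a | ∀ i j, ‖M i j‖ ≤ C} = (Set.univ.pi fun _ : a => Set.univ.pi fun _ : a =>
      Metric.closedBall (0 : ℂ) C : Set (a → a → ℂ)) := Set.ext fun M =>
    ⟨fun hM i _ j _ => mem_closedBall_zero_iff.2 (hM i j),
      fun hM i j => mem_closedBall_zero_iff.1 (hM i trivial j trivial)⟩
  rw [h2]
  exact h

end Norms

/-! ### From vanishing error to exact feasibility -/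

section Limit

variable {A₀ B₀ A₁ B₁ : Type*} [Fintype A₀] [Fintype B₀] [Fintype A₁] [Fintype B₁]

theorem continuous_margA₀B₀B₁ :
    Continuous (margA₀B₀B₁ : Op ((A₀ × B₀) × (A₁ × B₁)) → Op ((A₀ × B₀) × B₁)) :=
  continuous_matrix fun _ _ => continuous_finsetSum _ fun _ _ => continuous_id.matrix_elem _ _

theorem continuous_margA₀A₁B₀ :
    Continuous (margA₀A₁B₀ : Op ((A₀ × B₀) × (A₁ × B₁)) → Op ((A₀ × B₀) × A₁)) :=
  continuous_matrix fun _ _ => continuous_finsetSum _ fun _ _ => continuous_id.matrix_elem _ _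

variable [DecidableEq A₀] [DecidableEq B₀] [DecidableEq A₁] [DecidableEq B₁]

theorem continuous_mixA₀ :
    Continuous (mixA₀ : Op ((A₀ × B₀) × B₁) → Op ((A₀ × B₀) × B₁)) :=
  continuous_matrix fun _ _ => continuous_const.mul
    (continuous_finsetSum _ fun _ _ => continuous_id.matrix_elem _ _)

theorem continuous_mixB₀ :
    Continuous (mixB₀ : Op ((A₀ × B₀) × A₁) → Op ((A₀ × B₀) × A₁)) :=
  continuous_matrix fun _ _ => continuous_const.mul
    (continuous_finsetSum _ fun _ _ => continuous_id.matrix_elem _ _)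

/-- The Choi operators of channels for which the program is feasible at `m`. -/
def feasibleChoi (m : ℝ) : Set (Op ((A₀ × B₀) × (A₁ × B₁))) :=
  {J | (J.PosSemidef ∧ ∀ i j, ∑ o, J (i, o) (j, o) = (1 : Op (A₀ × B₀)) i j) ∧
    ∃ V W X, SDPFeasible J m V W X}

/-- It is the projection of a compact set of tuples `(J, V, W, X)`, so limits of feasible `J` keep
their witnesses. -/
theorem isClosed_feasibleChoi [Nonempty A₀] [Nonempty B₀] (m : ℝ) :
    IsClosed (feasibleChoi m : Set (Op ((A₀ × B₀) × (A₁ × B₁)))) := by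
  let T := Op ((A₀ × B₀) × (A₁ × B₁))
  let S : Set (T × T × T × T) := {z |
    (z.1.PosSemidef ∧ ∀ i j, ∑ o, z.1 (i, o) (j, o) = (1 : Op (A₀ × B₀)) i j) ∧
      SDPFeasible z.1 m z.2.1 z.2.2.1 z.2.2.2}
  have hS : feasibleChoi m = Prod.fst '' S := by
    ext J
    constructor
    · rintro ⟨h1, V, W, X, h2⟩
      exact ⟨(J, V, W, X), ⟨h1, h2⟩, rfl⟩
    · rintro ⟨⟨J, V, W, X⟩, ⟨h1, h2⟩, rfl⟩
      exact ⟨h1, V, W, X, h2⟩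
  rw [hS]
  -- The common trace of `V`, `W`, `X`; it also bounds the trace of `J` because `1 ≤ m`.
  set C : ℝ := m * Fintype.card (A₀ × B₀) with hC
  have hsub : S ⊆ {M : T | ∀ i j, ‖M i j‖ ≤ C} ×ˢ {M : T | ∀ i j, ‖M i j‖ ≤ C} ×ˢ
      {M : T | ∀ i j, ‖M i j‖ ≤ C} ×ˢ {M : T | ∀ i j, ‖M i j‖ ≤ C} := by
    rintro ⟨J, V, W, X⟩ ⟨⟨h1, h2⟩, h3⟩
    dsimp only at h1 h2 h3
    have hN : IsChannel (ofChoi J) := by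
      rw [isChannel_iff, choi_ofChoi]
      exact ⟨h1, h2⟩
    rw [← choi_ofChoi J] at h3
    have hm := h3.one_le hN
    have htr : ∀ Z : T, ∀ t : ℝ, (∀ i j, ∑ o, Z (i, o) (j, o) = t * (1 : Op (A₀ × B₀)) i j) →
        Z.trace.re = t * Fintype.card (A₀ × B₀) := by
      intro Z t hZ
      rw [trace_eq_sum_sum]
      simp only [hZ, Matrix.one_apply_eq]
      simp [mul_comm]
    have hV := htr V m (h3.sum_V hN)
    have hW := htr W m (h3.sum_W hN)
    have hX := htr X m (h3.sum_X hN)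
    have hJ := htr J 1 (by simpa using h2)
    have hps : ∀ Z : T, (Z - choi (ofChoi J)).PosSemidef → Z.PosSemidef := fun Z hZ => by
      have := hZ.add h1
      rwa [choi_ofChoi, sub_add_cancel] at this
    refine ⟨fun i j => (norm_apply_le_trace h1 i j).trans ?_,
      fun i j => (norm_apply_le_trace (hps V h3.V_ge) i j).trans hV.le,
      fun i j => (norm_apply_le_trace (hps W h3.W_ge) i j).trans hW.le,
      fun i j => (norm_apply_le_trace (hps X h3.X_ge) i j).trans hX.le⟩
    rw [hJ, hC]
    gcongr
  have hclosed : IsClosed S := by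
    have hJ : Continuous fun z : T × T × T × T => z.1 := continuous_fst
    have hV : Continuous fun z : T × T × T × T => z.2.1 := continuous_snd.fst
    have hW : Continuous fun z : T × T × T × T => z.2.2.1 := continuous_snd.snd.fst
    have hX : Continuous fun z : T × T × T × T => z.2.2.2 := continuous_snd.snd.snd
    have hS' : S = {z | z.1.PosSemidef} ∩
        (⋂ i, ⋂ j, {z | ∑ o, z.1 (i, o) (j, o) = (1 : Op (A₀ × B₀)) i j}) ∩
        {z | (z.2.1 - z.1).PosSemidef} ∩ {z | (z.2.2.1 - z.1).PosSemidef} ∩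
        {z | (z.2.2.2 - z.1).PosSemidef} ∩
        {z | margA₀B₀B₁ z.2.2.2 = mixA₀ (margA₀B₀B₁ z.2.2.2)} ∩
        {z | margA₀A₁B₀ z.2.2.2 = mixB₀ (margA₀A₁B₀ z.2.2.2)} ∩
        {z | (m : ℂ) • margA₀B₀B₁ z.1 = margA₀B₀B₁ z.2.2.1} ∩
        {z | margA₀B₀B₁ z.2.2.2 = margA₀B₀B₁ z.2.1} ∩
        {z | (m : ℂ) • margA₀A₁B₀ z.1 = margA₀A₁B₀ z.2.1} ∩
        {z | margA₀A₁B₀ z.2.2.2 = margA₀A₁B₀ z.2.2.1} := by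
      ext z
      simp only [Set.mem_inter_iff, Set.mem_iInter, Set.mem_ofPred_eq]
      constructor
      · rintro ⟨⟨h1, h2⟩, h⟩
        exact ⟨⟨⟨⟨⟨⟨⟨⟨⟨⟨h1, h2⟩, h.V_ge⟩, h.W_ge⟩, h.X_ge⟩, isNonsignallingA_iff.1 h.X_nsA⟩,
          isNonsignallingB_iff.1 h.X_nsB⟩, h.W_A₀B₀B₁⟩, h.X_V_A₀B₀B₁⟩, h.V_A₀A₁B₀⟩, h.X_W_A₀A₁B₀⟩
      · rintro ⟨⟨⟨⟨⟨⟨⟨⟨⟨⟨h1, h2⟩, h3⟩, h4⟩, h5⟩, h6⟩, h7⟩, h8⟩, h9⟩, h10⟩, h11⟩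
        exact ⟨⟨h1, h2⟩, ⟨h3, h4, h5, isNonsignallingA_iff.2 h6, isNonsignallingB_iff.2 h7, h8,
          h9, h10, h11⟩⟩
    rw [hS']
    have hA := continuous_margA₀B₀B₁ (A₀ := A₀) (B₀ := B₀) (A₁ := A₁) (B₁ := B₁)
    have hB := continuous_margA₀A₁B₀ (A₀ := A₀) (B₀ := B₀) (A₁ := A₁) (B₁ := B₁)
    refine IsClosed.inter (IsClosed.inter (IsClosed.inter (IsClosed.inter (IsClosed.inter
      (IsClosed.inter (IsClosed.inter (IsClosed.inter (IsClosed.inter (IsClosed.inter ?_ ?_)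
        ?_) ?_) ?_) ?_) ?_) ?_) ?_) ?_) ?_
    · exact isClosed_posSemidef.preimage hJ
    · exact isClosed_iInter fun i => isClosed_iInter fun j => isClosed_eq
        (continuous_finsetSum _ fun o _ => hJ.matrix_elem _ _) continuous_const
    · exact isClosed_posSemidef.preimage (hV.sub hJ)
    · exact isClosed_posSemidef.preimage (hW.sub hJ)
    · exact isClosed_posSemidef.preimage (hX.sub hJ)
    · exact isClosed_eq (hA.comp hX) (continuous_mixA₀.comp (hA.comp hX))
    · exact isClosed_eq (hB.comp hX) (continuous_mixB₀.comp (hB.comp hX))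
    · exact isClosed_eq (Continuous.const_smul (hA.comp hJ) (m : ℂ)) (hA.comp hW)
    · exact isClosed_eq (hA.comp hX) (hA.comp hV)
    · exact isClosed_eq (Continuous.const_smul (hB.comp hJ) (m : ℂ)) (hB.comp hV)
    · exact isClosed_eq (hB.comp hX) (hB.comp hW)
  have hK := isCompact_entries_le (a := (A₀ × B₀) × (A₁ × B₁)) C
  exact (((hK.prod (hK.prod (hK.prod hK))).of_isClosed_subset hclosed hsub).image
    continuous_fst).isClosed

variable [Nonempty A₀] [Nonempty B₀] [Nonempty A₁] [Nonempty B₁]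

/-- Exact simulation by `n` messages is equivalent to feasibility at `n`. -/
theorem simError_noiseless_le_zero_iff {N : LMap (A₀ × B₀) (A₁ × B₁)} (hN : IsChannel N) {n : ℕ}
    (hn : 0 < n) :
    simError (noiseless n) N ≤ 0 ↔ ∃ V W X, SDPFeasible (choi N) n V W X := by
  have : NeZero n := ⟨hn.ne'⟩
  constructor
  · intro h
    have h1 : (⨅ (Θ : SuperMap (Fin n × Fin n) (Fin n × Fin n) (A₀ × B₀) (A₁ × B₁))
        (_ : IsNSSuperchannel Θ), diamondNorm (Θ (noiseless n) - N)) = 0 := by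
      rcases mul_eq_zero.1 (le_zero_iff.1 h) with h2 | h2
      · simp at h2
      · exact h2
    -- No optimal superchannel is assumed to exist; a sequence of nearly optimal ones is enough.
    have h2 : ∀ k : ℕ, ∃ Θ : SuperMap (Fin n × Fin n) (Fin n × Fin n) (A₀ × B₀) (A₁ × B₁),
        IsNSSuperchannel Θ ∧
          diamondNorm (Θ (noiseless n) - N) < ENNReal.ofReal (1 / ((k : ℝ) + 1)) := by
      intro k
      have h3 : (0 : ℝ≥0∞) < ENNReal.ofReal (1 / ((k : ℝ) + 1)) :=
        ENNReal.ofReal_pos.2 Nat.one_div_pos_of_nat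
      rw [← h1] at h3
      obtain ⟨Θ, h4⟩ := iInf_lt_iff.1 h3
      obtain ⟨h5, h6⟩ := iInf_lt_iff.1 h4
      exact ⟨Θ, h5, h6⟩
    choose Θ hΘ hlt using h2
    have hmem : ∀ k, choi (Θ k (noiseless n)) ∈
        (feasibleChoi n : Set (Op ((A₀ × B₀) × (A₁ × B₁)))) := by
      intro k
      refine ⟨isChannel_iff.1 ?_, _, _, _, (hΘ k).sdpFeasible⟩
      rw [noiseless_eq_shift]
      exact (hΘ k).isSuperchannel.isChannel (isChannel_shift 0 0)
    have hlim : Filter.Tendsto (fun k => choi (Θ k (noiseless n))) Filter.atTop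
        (nhds (choi N)) := by
      refine tendsto_pi_nhds.2 fun p => tendsto_pi_nhds.2 fun q => ?_
      rw [tendsto_iff_norm_sub_tendsto_zero]
      have h3 : Filter.Tendsto
          (fun k : ℕ => (Fintype.card (A₀ × B₀) : ℝ) * (1 / ((k : ℝ) + 1))) Filter.atTop
          (nhds 0) := by
        simpa using tendsto_one_div_add_atTop_nhds_zero_nat.const_mul
          (Fintype.card (A₀ × B₀) : ℝ)
      exact squeeze_zero (fun k => norm_nonneg _)
        (fun k => norm_choi_le_of_diamondNorm_lt _ Nat.one_div_pos_of_nat (hlt k) p q) h3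
    exact ((isClosed_feasibleChoi _).mem_of_tendsto hlim (Filter.Eventually.of_forall hmem)).2
  · rintro ⟨V, W, X, h⟩
    obtain ⟨Θ, hΘ, hΘN⟩ := h.exists_isNSSuperchannel hN
    have h1 : (⨅ (Θ : SuperMap (Fin n × Fin n) (Fin n × Fin n) (A₀ × B₀) (A₁ × B₁))
        (_ : IsNSSuperchannel Θ), diamondNorm (Θ (noiseless n) - N)) ≤ 0 := by
      refine iInf₂_le_of_le Θ hΘ ?_
      rw [hΘN, sub_self, diamondNorm_zero]
    rw [simError, le_zero_iff.1 h1, mul_zero]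

end Limit

/-! ### The cost and the conditional min-entropy -/

theorem log2_ofReal {x : ℝ} (hx : 0 < x) : log2 (ENNReal.ofReal x) = (Real.logb 2 x : EReal) := by
  have h2 : (2 : ℝ≥0∞) = ENNReal.ofReal 2 := by simp
  rw [log2, h2, ENNReal.log_ofReal_of_pos hx, ENNReal.log_ofReal_of_pos two_pos, ← EReal.coe_div]
  rfl

theorem log2_mono : Monotone log2 := fun _ _ h =>
  EReal.div_le_div_right_of_nonneg (ENNReal.zero_le_log_iff.2 one_le_two) (ENNReal.log_le_log h)

section Cost

variable {A₀ B₀ A₁ B₁ : Type*} [Fintype A₀] [Fintype B₀] [Fintype A₁] [Fintype B₁]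
  [DecidableEq A₀] [DecidableEq B₀] [DecidableEq A₁] [DecidableEq B₁]
  [Nonempty A₀] [Nonempty B₀] [Nonempty A₁] [Nonempty B₁]

/-- The one-shot exact cost is the logarithm of the optimal value of the program. -/
theorem IsChannel.exists_isLeast_sdpValues {N : LMap (A₀ × B₀) (A₁ × B₁)} (hN : IsChannel N) :
    ∃ k : ℤ, IsLeast (sdpValues N) k ∧ oneShotCost 0 N = ((Real.logb 2 (k : ℝ) : ℝ) : EReal) := by
  classical
  let P : ℕ → Prop := fun n => 0 < n ∧ ∃ V W X, SDPFeasible (choi N) n V W X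
  -- Monotonicity lifts a real `m` to its ceiling, so minimising `⌈m⌉` amounts to finding the least
  -- feasible positive integer.
  have hP : ∀ m V W X, SDPFeasible (choi N) m V W X → P ⌈m⌉₊ := fun m V W X h =>
    ⟨Nat.ceil_pos.2 (zero_lt_one.trans_le (h.one_le hN)), _, _, _, h.mono hN (Nat.le_ceil m)⟩
  have hex : ∃ n, P n := by
    obtain ⟨m, V, W, X, h⟩ := hN.exists_sdpFeasible
    exact ⟨_, hP m V W X h⟩
  obtain ⟨hpos, V, W, X, hfeas⟩ := Nat.find_spec hex
  have hmin : ∀ n, P n → Nat.find hex ≤ n := fun n hn => Nat.find_min' hex hn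
  generalize Nat.find hex = n at hpos hfeas hmin
  refine ⟨n, ⟨⟨n, V, W, X, hfeas, by simp⟩, ?_⟩, ?_⟩
  · rintro _ ⟨m, V', W', X', h, rfl⟩
    rw [← Int.natCast_ceil_eq_ceil (zero_le_one.trans (h.one_le hN))]
    exact_mod_cast hmin _ (hP _ _ _ _ h)
  · have h1 : (⨅ (m : ℕ) (_ : 0 < m ∧ simError (noiseless m) N ≤ 0), (m : ℝ≥0∞)) =
        ENNReal.ofReal n := by
      rw [ENNReal.ofReal_natCast]
      refine le_antisymm (iInf₂_le_of_le n ⟨hpos, ?_⟩ le_rfl) (le_iInf₂ fun m hm => ?_)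
      · exact (simError_noiseless_le_zero_iff hN hpos).2 ⟨V, W, X, hfeas⟩
      · exact_mod_cast hmin m ⟨hm.1, (simError_noiseless_le_zero_iff hN hm.1).1 hm.2⟩
    rw [oneShotCost, h1, log2_ofReal (by exact_mod_cast hpos)]
    simp

end Cost

/-! ### Point-to-point channels and the min-entropy -/

section PointToPoint

variable {A B : Type*} [Fintype A] [Fintype B] [DecidableEq A] [DecidableEq B]

theorem choi_pointToPoint (M : LMap A B) (a a' : A) (b b' : B) :
    choi (pointToPoint M) ((a, ()), ((), b)) ((a', ()), ((), b')) = choi M (a, b) (a', b') := by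
  have h : (Matrix.reindexLinearEquiv ℂ ℂ (Equiv.prodPUnit A) (Equiv.prodPUnit A))
      (Matrix.single (a, ()) (a', ()) 1) = Matrix.single a a' (1 : ℂ) := by
    ext i j
    simp [Matrix.single_apply]
  simp only [choi, pointToPoint, Matrix.of_apply, LinearMap.comp_apply, LinearEquiv.coe_coe, h]
  rfl

theorem choi_pointToPoint_eq (M : LMap A B) :
    choi (pointToPoint M) = (choi M).submatrix (fun p => (p.1.1, p.2.2)) fun p => (p.1.1, p.2.2) := by
  ext ⟨⟨a, _⟩, _, b⟩ ⟨⟨a', _⟩, _, b'⟩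
  exact choi_pointToPoint M a a' b b'

theorem IsChannel.pointToPoint {M : LMap A B} (hM : IsChannel M) : IsChannel (pointToPoint M) := by
  rw [isChannel_iff, choi_pointToPoint_eq]
  refine ⟨hM.posSemidef.submatrix _, ?_⟩
  rintro ⟨a, _⟩ ⟨a', _⟩
  rw [Fintype.sum_prod_type]
  simpa [Matrix.one_apply] using hM.sum_choi a a'

variable [Nonempty A] [Nonempty B]

/-- For a point-to-point channel, the program reduces to the one of the conditional min-entropy. -/
theorem exists_sdpFeasible_pointToPoint_iff {M : LMap A B} (hM : IsChannel M) {m : ℝ} :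
    (∃ V W X, SDPFeasible (choi (pointToPoint M)) m V W X) ↔
      1 ≤ m ∧ ∃ Y : Op B, Y.PosSemidef ∧ Y.trace = m ∧ ((1 : Op A) ⊗ₖ Y - choi M).PosSemidef := by
  have hd : (Fintype.card A : ℂ) ≠ 0 := by simp
  constructor
  · rintro ⟨V, W, X, h⟩
    refine ⟨h.one_le hM.pointToPoint, ?_⟩
    have hX : X.PosSemidef := by
      have := h.X_ge.add hM.pointToPoint.posSemidef
      rwa [sub_add_cancel] at this
    -- The marginal of `X` on B₁. Since A₁ and B₀ are trivial, non-signalling from Alice determines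
    -- all of `X` as `π ⊗ Z`.
    let Z : Op B := ∑ w : A, X.submatrix (fun b => ((w, ()), ((), b))) fun b => ((w, ()), ((), b))
    have hZ : ∀ a a' b b', X ((a, ()), ((), b)) ((a', ()), ((), b')) =
        maxMixed A a a' * Z b b' := by
      intro a a' b b'
      have h1 := congrFun (congrFun (isNonsignallingA_iff.1 h.X_nsA) ((a, ()), b)) ((a', ()), b')
      simpa [margA₀B₀B₁, mixA₀, Z, Matrix.sum_apply] using h1
    refine ⟨(Fintype.card A : ℂ)⁻¹ • Z,
      (Matrix.posSemidef_sum _ fun w _ => hX.submatrix _).smul (by simp), ?_, ?_⟩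
    · have h1 : Z.trace = Fintype.card A * m := by
        have h2 : ∀ w : A, ∑ b, X ((w, ()), ((), b)) ((w, ()), ((), b)) = m := by
          intro w
          have h3 := h.sum_X hM.pointToPoint (w, ()) (w, ())
          rw [Fintype.sum_prod_type] at h3
          simpa using h3
        simp only [Z, Matrix.trace_sum]
        simp [Matrix.trace, h2]
      rw [Matrix.trace_smul, h1, smul_eq_mul, inv_mul_cancel_left₀ hd]
    · convert h.X_ge.submatrix fun p : A × B => ((p.1, ()), ((), p.2)) using 1
      ext ⟨a, b⟩ ⟨a', b'⟩
      rw [Matrix.submatrix_apply, Matrix.sub_apply, Matrix.sub_apply, hZ, choi_pointToPoint]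
      simp only [Matrix.kroneckerMap_apply, maxMixed, Matrix.smul_apply, smul_eq_mul]
      ring
  · rintro ⟨hm, Y, hY, htr, hle⟩
    have hA : margA₀A₁B₀ (((1 : Op A) ⊗ₖ Y).submatrix (fun p => (p.1.1, p.2.2))
        (fun p => (p.1.1, p.2.2)) : Op ((A × Unit) × (Unit × B))) =
        (m : ℂ) • margA₀A₁B₀ (choi (pointToPoint M)) := by
      ext ⟨⟨a, _⟩, _⟩ ⟨⟨a', _⟩, _⟩
      change ∑ b, (1 : Op A) a a' * Y b b =
        m * ∑ b, choi (pointToPoint M) ((a, ()), ((), b)) ((a', ()), ((), b))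
      simp only [choi_pointToPoint, hM.sum_choi, ← Finset.mul_sum]
      rw [← htr, mul_comm]
      rfl
    have hle' := hle.submatrix fun p : (A × Unit) × (Unit × B) => (p.1.1, p.2.2)
    rw [Matrix.submatrix_sub, Pi.sub_apply, Pi.sub_apply, ← choi_pointToPoint_eq] at hle'
    -- `V = X = 1 ⊗ Y`. With A₁ trivial, the constraint on the A₀B₀B₁ marginal forces `W = m J`, and
    -- `1 ≤ m` is what `W ≥ J` needs.
    refine ⟨_, (m : ℂ) • choi (pointToPoint M), _, hle', ?_, hle', ?_, ?_, ?_, rfl, hA.symm, ?_⟩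
    · have h1 : (0 : ℂ) ≤ (m : ℂ) - 1 := by
        rw [sub_nonneg]
        exact_mod_cast hm
      have h2 := hM.pointToPoint.posSemidef.smul h1
      rwa [sub_smul, one_smul] at h2
    · refine isNonsignallingA_iff.2 ?_
      ext ⟨⟨a, _⟩, b⟩ ⟨⟨a', _⟩, b'⟩
      change ∑ _x : Unit, (1 : Op A) a a' * Y b b' =
        maxMixed A a a' * ∑ w : A, ∑ _x : Unit, (1 : Op A) w w * Y b b'
      simp only [maxMixed, Matrix.smul_apply, Matrix.one_apply_eq, Finset.sum_const,
        Finset.card_univ, Fintype.card_unit, one_smul, one_mul, smul_eq_mul, nsmul_eq_mul]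
      field_simp
    · refine isNonsignallingB_iff.2 ?_
      ext ⟨⟨a, _⟩, b⟩ ⟨⟨a', _⟩, b'⟩
      simp [margA₀A₁B₀, mixB₀, maxMixed]
    · rw [margA₀B₀B₁_smul]
    · rw [hA, margA₀A₁B₀_smul]

theorem isClosed_dominating (J : Op (A × B)) :
    IsClosed {Y : Op B | ((1 : Op A) ⊗ₖ Y - J).PosSemidef} := by
  refine isClosed_posSemidef.preimage (f := fun Y : Op B => (1 : Op A) ⊗ₖ Y - J)
    (Continuous.sub (continuous_matrix fun p q => ?_) continuous_const)
  exact continuous_const.mul (continuous_id.matrix_elem _ _)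

/-- The minimal trace of an operator `Y` with `J ≤ 1 ⊗ Y` is attained. -/
theorem exists_min_trace {M : LMap A B} (hM : IsChannel M) :
    ∃ t : ℝ, 1 ≤ t ∧
      (∃ Y : Op B, Y.PosSemidef ∧ Y.trace = t ∧ ((1 : Op A) ⊗ₖ Y - choi M).PosSemidef) ∧
      ∀ Y : Op B, Y.PosSemidef → ((1 : Op A) ⊗ₖ Y - choi M).PosSemidef → t ≤ Y.trace.re := by
  obtain ⟨m, V, W, X, h⟩ := hM.pointToPoint.exists_sdpFeasible
  obtain ⟨-, Y₀, hY₀, htr₀, hle₀⟩ := (exists_sdpFeasible_pointToPoint_iff hM).1 ⟨V, W, X, h⟩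
  have hcont : Continuous fun Y : Op B => Y.trace.re :=
    Complex.continuous_re.comp continuous_id.matrix_trace
  -- Cutting off at the trace of a known admissible operator gives compactness; whatever is cut off
  -- has larger trace.
  let S : Set (Op B) := {Y | Y.PosSemidef} ∩ {Y | ((1 : Op A) ⊗ₖ Y - choi M).PosSemidef} ∩
    {Y | Y.trace.re ≤ m}
  have hS : IsCompact S := by
    refine (isCompact_entries_le (a := B) m).of_isClosed_subset
      ((isClosed_posSemidef.inter (isClosed_dominating _)).inter
        (isClosed_le hcont continuous_const)) ?_
    rintro Y ⟨⟨hY, -⟩, htr⟩ i j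
    exact (norm_apply_le_trace hY i j).trans htr
  have hY₀S : Y₀ ∈ S := ⟨⟨hY₀, hle₀⟩, by simp [htr₀]⟩
  obtain ⟨Y, ⟨⟨hY, hle⟩, htr⟩, hmin⟩ := hS.exists_isMinOn ⟨Y₀, hY₀S⟩ hcont.continuousOn
  have hreal : Y.trace = (Y.trace.re : ℂ) := by
    have := hY.trace_nonneg
    rw [Complex.nonneg_iff] at this
    exact Complex.ext (by simp) (by simp [← this.2])
  refine ⟨Y.trace.re, ?_, ⟨Y, hY, hreal, hle⟩, fun Z hZ hZle => ?_⟩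
  · obtain ⟨a⟩ := ‹Nonempty A›
    have h1 : (0 : ℂ) ≤ ∑ b, ((1 : Op A) ⊗ₖ Y - choi M) (a, b) (a, b) :=
      Finset.sum_nonneg fun b _ => hle.diag_nonneg
    simp only [Matrix.sub_apply, Finset.sum_sub_distrib, hM.sum_choi, Matrix.kroneckerMap_apply,
      Matrix.one_apply_eq, one_mul, sub_nonneg] at h1
    have h2 : (1 : ℂ) ≤ Y.trace := h1
    rw [hreal] at h2
    exact_mod_cast h2
  · by_cases hZm : Z.trace.re ≤ m
    · exact hmin ⟨⟨hZ, hZle⟩, hZm⟩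
    · exact htr.trans (le_of_not_ge hZm)

/-- The substitution `Y = t σ` identifies pairs `(t, σ)` with `J ≤ t (1 ⊗ σ)` with operators `Y` of
trace `t`, so both optima come from the least trace. The ceiling is monotone and preserves the
minimum. -/
theorem IsChannel.exists_condMinEntropy {M : LMap A B} (hM : IsChannel M) :
    ∃ h : ℝ, condMinEntropy (choi M) = (h : EReal) ∧
      IsLeast (sdpValues (BiCost.pointToPoint M)) ⌈(2 : ℝ) ^ (-h)⌉ := by
  obtain ⟨t, ht, ⟨Y, hY, htr, hle⟩, hmin⟩ := exists_min_trace hM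
  have ht0 : 0 < t := zero_lt_one.trans_le ht
  have htC : (t : ℂ) ≠ 0 := by exact_mod_cast ht0.ne'
  refine ⟨-Real.logb 2 t, ?_, ?_⟩
  · rw [condMinEntropy, EReal.coe_neg, ← log2_ofReal ht0]
    congr 1
    refine le_antisymm (iInf₂_le_of_le ((t : ℂ)⁻¹ • Y) ⟨hY.smul ?_, ?_⟩ ?_)
      (le_iInf₂ fun σ hσ => log2_mono (le_iInf₂ fun s hs => ?_))
    · rw [← Complex.ofReal_inv]
      exact Complex.zero_le_real.2 (inv_nonneg.2 ht0.le)
    · rw [Matrix.trace_smul, htr, smul_eq_mul, inv_mul_cancel₀ htC]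
    · refine log2_mono (iInf₂_le_of_le t.toNNReal ?_ le_rfl)
      rwa [Real.coe_toNNReal _ ht0.le, Matrix.kronecker_smul, smul_inv_smul₀ htC]
    · rw [← Matrix.kronecker_smul] at hs
      have h1 := hmin _ (hσ.1.smul (Complex.zero_le_real.2 s.2)) hs
      rw [Matrix.trace_smul, hσ.2, smul_eq_mul, mul_one, Complex.ofReal_re] at h1
      rw [← ENNReal.ofReal_coe_nnreal]
      exact ENNReal.ofReal_le_ofReal h1
  · rw [neg_neg, Real.rpow_logb two_pos (by norm_num) ht0]
    constructor
    · obtain ⟨V, W, X, h⟩ := (exists_sdpFeasible_pointToPoint_iff hM).2 ⟨ht, Y, hY, htr, hle⟩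
      exact ⟨t, V, W, X, h, rfl⟩
    · rintro _ ⟨m, V, W, X, h, rfl⟩
      obtain ⟨-, Z, hZ, hZtr, hZle⟩ := (exists_sdpFeasible_pointToPoint_iff hM).1 ⟨V, W, X, h⟩
      have h1 := hmin Z hZ hZle
      rw [hZtr, Complex.ofReal_re] at h1
      exact Int.ceil_mono h1

end PointToPoint

end BiCost

theorem mainTheorem4 {A₀ B₀ A₁ B₁ : Type*}
    [Fintype A₀] [Fintype B₀] [Fintype A₁] [Fintype B₁]
    [DecidableEq A₀] [DecidableEq B₀] [DecidableEq A₁] [DecidableEq B₁]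
    [Nonempty A₀] [Nonempty B₀] [Nonempty A₁] [Nonempty B₁] :
    (∀ N : BiCost.LMap (A₀ × B₀) (A₁ × B₁), BiCost.IsChannel N →
      ∃ k : ℤ, IsLeast (BiCost.sdpValues N) k ∧
        BiCost.oneShotCost 0 N = ((Real.logb 2 (k : ℝ) : ℝ) : EReal)) ∧
    (∀ M : BiCost.LMap A₀ B₁, BiCost.IsChannel M →
      ∃ h : ℝ, BiCost.condMinEntropy (BiCost.choi M) = (h : EReal) ∧
        IsLeast (BiCost.sdpValues (BiCost.pointToPoint M)) ⌈(2 : ℝ) ^ (-h)⌉ ∧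
        BiCost.oneShotCost 0 (BiCost.pointToPoint M) =
          ((Real.logb 2 (⌈(2 : ℝ) ^ (-h)⌉ : ℝ) : ℝ) : EReal)) := by
  refine ⟨fun N hN => hN.exists_isLeast_sdpValues, fun M hM => ?_⟩
  obtain ⟨h, h1, h2⟩ := hM.exists_condMinEntropy
  obtain ⟨k, h3, h4⟩ := hM.pointToPoint.exists_isLeast_sdpValues
  rw [h3.unique h2] at h4
  exact ⟨h, h1, h2, h4⟩
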